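/- Let $X$ be a finite connected CW complex, with $k$-skeleton $X^{(k)}$ and cellular chain complex $C_*(X;A)$, the free $A$-module on the cells, for $A=\mathbb Z$ or $\mathbb R$; homology is cellular, $Z_k$ and $B_k$ denote cycles and boundaries, and $\beta_k$ denotes the $k$-th Betti number. Let $\mathfrak h=\{\mathfrak h_k\}$ be a combinatorial homology basis: $\mathfrak h_k$ is a basis of the lattice $H_k(X;\mathbb Z)_0=\operatorname{im}(H_k(X;\mathbb Z)\to H_k(X;\mathbb R))$. Reidemeister torsion: choose for each $k$ a basis $\mathfrak b_k$ of $B_k(X;\mathbb R)$ and linear splittings $s_k: B_k(X;\mathbb R)\to C_{k+1}(X;\mathbb R)$ of $\partial$ and $t_k: H_k(X;\mathbb R)\to Z_k(X;\mathbb R)$ of the quotient map. Let $D_k$ be the determinant of the matrix expressing the basis $\mathfrak b_k\cup t_k(\mathfrak h_k)\cup s_{k-1}(\mathfrak b_{k-1})$ of $C_k(X;\mathbb R)$ in terms of the $k$-cells (with $B_{-1}=0$). Then $\tau^2(X;\mathfrak h)=\prod_{k\ge0}(D_k^2)^{(-1)^k}$, which does not depend on these choices. Put $T^0=\emptyset$,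 and for each $k\ge1$ let $T^k$ be a spanning tree of $X^{(k)}$: a subcomplex with $X^{(k-1)}\subset T^k\subset X^{(k)}$, $H_k(T^k;\mathbb Z)=0$ and $\beta_{k-1}(T^k)=\beta_{k-1}(X^{(k)})$. For each $k\ge0$ let $V^k$ be a homology truncation of $X$ in degree $k$ subordinate to $T^k$: a subcomplex with $T^k\subset V^k\subset X^{(k)}$ such that the inclusion induces isomorphisms $H_j(V^k;\mathbb R)\to H_j(X;\mathbb R)$ for all $j\le k$. For $Y=T^k$ or $Y=V^k$ let $\theta_Y$ be the order of the torsion subgroup of $H_{k-1}(Y;\mathbb Z)$ (equal to $1$ if $k=0$). Let $q_k: B_k(T^{k+1};\mathbb Z)\to C_k(X,V^k;\mathbb Z)=C_k(X;\mathbb Z)/C_k(V^k;\mathbb Z)$ be the restriction of the quotient map, and let $t(q_k)$ be the order of its cokernel. Let $\chi_k$ be the square of the determinant of $H_k(V^k;\mathbb R)\to H_k(X;\mathbb R)$ with respect to a basis of the lattice $\operatorname{im}(H_k(V^k;\mathbb Z)\to H_k(V^k;\mathbb R))$ and the basis $\mathfrak h_k$. Then $$\tau^2(X;\mathfrak h)=\prod_{k\ge0}\left(\frac{\theta_{T^k}^2\,t(q_k)^2}{\theta_{V^k}^2\,\chi_k}\right)^{(-1)^k}.$$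 -/

import Mathlib

open Topology CategoryTheory
open Topology.RelCWComplex (cell map openCell Subcomplex skeleton)

set_option linter.unusedSectionVars false

noncomputable section

namespace CellTorsion

/-! ### Degrees of attaching maps -/

/-- A map defined on an open set `U`, and sent to infinity outside `U`, is continuous into the
one-point compactification if preimages of compact sets are closed. -/
theorem continuous_extend_infty {Y Z : Type*} [TopologicalSpace Y] [TopologicalSpace Z]
    (U : Set Y) [DecidablePred (· ∈ U)] (f : U → Z) (hU : IsOpen U) (hf : Continuous f)
    (hK : ∀ K : Set Z, IsCompact K → IsClosed (Subtype.val '' (f ⁻¹' K))) :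
    Continuous (fun y => if h : y ∈ U then (f ⟨y, h⟩ : OnePoint Z) else OnePoint.infty) := by
  refine ⟨fun s hs => ?_⟩
  by_cases hi : OnePoint.infty ∈ s
  · rw [OnePoint.isOpen_iff_of_mem hi] at hs
    have := hK _ hs.2
    rw [← isOpen_compl_iff] at this
    convert this using 1
    ext y
    by_cases hy : y ∈ U <;> simp [hy, hi]
  · rw [OnePoint.isOpen_iff_of_notMem hi] at hs
    have := hU.isOpenMap_subtype_val _ (hs.preimage hf)
    convert this using 1
    ext y
    by_cases hy : y ∈ U <;> simp [hy, hi]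

/-- The boundary of the cube `[-1,1]^(n+1)`, that is, the unit sphere for the maximum norm: the
model of the `n`-sphere used by the characteristic maps of Mathlib. -/
abbrev Sph (n : ℕ) : Type := Metric.sphere (0 : Fin (n + 1) → ℝ) 1

/-- The one-point compactification of the open `n`-cell, a model of `D^n / S^(n-1)`. -/
abbrev Pinch (n : ℕ) : Type := OnePoint (Metric.ball (0 : Fin n → ℝ) 1)

open Classical in
/-- The reference map of degree one: it sends the interior of the face `x₀ = 1` of the cube
identically onto the open `n`-cell and collapses the rest of the sphere to the point at infinity
(outward normal first orientation of the boundary). -/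
def refMap (n : ℕ) (x : Sph n) : Pinch n :=
  if h : x ∈ {x : Sph n | 0 < x.1 0 ∧ Fin.tail x.1 ∈ Metric.ball (0 : Fin n → ℝ) 1} then
    ((⟨Fin.tail x.1, h.2⟩ : Metric.ball (0 : Fin n → ℝ) 1) : Pinch n)
  else OnePoint.infty

theorem refMap_face {n : ℕ} (x : Sph n) (h : Fin.tail x.1 ∈ Metric.ball (0 : Fin n → ℝ) 1) :
    |x.1 0| = 1 := by
  have hx : ‖x.1‖ = 1 := mem_sphere_zero_iff_norm.1 x.2
  have h' : ‖Fin.tail x.1‖ < 1 := by simpa using h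
  refine le_antisymm ((norm_le_pi_norm x.1 0).trans hx.le) ?_
  by_contra hlt
  push Not at hlt
  have : ‖x.1‖ < 1 := by
    rw [pi_norm_lt_iff one_pos] at h' ⊢
    intro i
    refine Fin.cases ?_ (fun j => ?_) i
    · exact hlt
    · exact h' j
  linarith

theorem continuous_refMap (n : ℕ) : Continuous (refMap n) := by
  classical
  have htail : Continuous fun x : Sph n => Fin.tail x.1 :=
    continuous_pi fun i => (continuous_apply i.succ).comp continuous_subtype_val
  have h0 : Continuous fun x : Sph n => x.1 0 :=
    (continuous_apply 0).comp continuous_subtype_val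
  unfold refMap
  refine continuous_extend_infty
    {x : Sph n | 0 < x.1 0 ∧ Fin.tail x.1 ∈ Metric.ball (0 : Fin n → ℝ) 1}
    (fun x => (⟨Fin.tail x.1.1, x.2.2⟩ : Metric.ball (0 : Fin n → ℝ) 1)) ?_ ?_ ?_
  · exact (isOpen_lt continuous_const h0).inter (Metric.isOpen_ball.preimage htail)
  · exact Continuous.subtype_mk (htail.comp continuous_subtype_val) _
  · intro K hK
    have hc : IsClosed {x : Sph n | 1 ≤ x.1 0 ∧ Fin.tail x.1 ∈ Subtype.val '' K} :=
      (isClosed_le continuous_const h0).inter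
        ((hK.image continuous_subtype_val).isClosed.preimage htail)
    convert hc using 1
    ext x
    constructor
    · rintro ⟨y, hy, rfl⟩
      have h1 := refMap_face y.1 y.2.2
      rw [abs_of_pos y.2.1] at h1
      exact ⟨h1.ge, _, hy, rfl⟩
    · rintro ⟨h1, z, hz, hzx⟩
      refine ⟨⟨x, lt_of_lt_of_le one_pos h1, hzx ▸ z.2⟩, ?_, rfl⟩
      show (⟨Fin.tail x.1, _⟩ : Metric.ball (0 : Fin n → ℝ) 1) ∈ K
      convert hz
      exact hzx.symm

/-- The map induced on `n`-th singular homology with integer coefficients. -/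
abbrev singularMap (n : ℕ) {Y Z : Type} [TopologicalSpace Y] [TopologicalSpace Z] (g : C(Y, Z)) :=
  ((AlgebraicTopology.singularHomologyFunctor (ModuleCat.{0} ℤ) n).obj (ModuleCat.of ℤ ℤ)).map
    (TopCat.ofHom g)

open Classical in
/-- The degree (for `n ≥ 1`) of a map from the `n`-sphere to `D^n / S^(n-1)`: the integer `d` such
that on `n`-th integral singular homology the map induces `d` times the isomorphism induced by the
reference map of degree one. -/
def degree {n : ℕ} (g : C(Sph n, Pinch n)) : ℤ :=
  if h : ∃ d : ℤ, singularMap n g = d • singularMap n ⟨refMap n, continuous_refMap n⟩ then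
    h.choose
  else 0

section Complex

universe u

variable {X : Type u} [TopologicalSpace X] (C : Set X) [CWComplex C]

theorem symm_mem_ball {C : Set X} [CWComplex C] {n : ℕ} (e : cell C n) {x : X}
    (hx : x ∈ openCell n e) : (map n e).symm x ∈ Metric.ball (0 : Fin n → ℝ) 1 := by
  rw [openCell, ← RelCWComplex.source_eq n e, (map n e).image_source_eq_target] at hx
  rw [← RelCWComplex.source_eq n e]
  exact (map n e).map_target hx

open Classical in
/-- The attaching map of the `(n+1)`-cell `e`, followed by the collapse of the complement of the
open `n`-cell `e'` to the point at infinity. -/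
def attachCollapse {C : Set X} [CWComplex C] {n : ℕ} (e : cell C (n + 1)) (e' : cell C n)
    (x : Sph n) : Pinch n :=
  if h : x ∈ {x : Sph n | map (n + 1) e x.1 ∈ openCell n e'} then
    ((⟨(map n e').symm (map (n + 1) e x.1), symm_mem_ball e' h⟩ :
      Metric.ball (0 : Fin n → ℝ) 1) : Pinch n)
  else OnePoint.infty

theorem continuous_attachCollapse {C : Set X} [T2Space X] [CWComplex C] [CWComplex.Finite C]
    {n : ℕ} (e : cell C (n + 1)) (e' : cell C n) : Continuous (attachCollapse e e') := by
  classical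
  have hφ : Continuous fun x : Sph n => map (n + 1) e x.1 := by
    have := (RelCWComplex.continuousOn (C := C) (n + 1) e).mono Metric.sphere_subset_closedBall
    exact continuousOn_iff_continuous_domRestrict.1 this
  have htar : openCell n e' = (map n e').target := by
    rw [openCell, ← RelCWComplex.source_eq n e', (map n e').image_source_eq_target]
  unfold attachCollapse
  refine continuous_extend_infty {x : Sph n | map (n + 1) e x.1 ∈ openCell n e'}
    (fun x => (⟨(map n e').symm (map (n + 1) e x.1.1), symm_mem_ball e' x.2⟩ :
      Metric.ball (0 : Fin n → ℝ) 1)) ?_ ?_ ?_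
  · have : Finite (cell C n) := RelCWComplex.FiniteType.finite_cell n
    have hcl : IsClosed ((RelCWComplex.skeletonLT C n : Set X) ∪
        ⋃ j : {j : cell C n // j ≠ e'}, RelCWComplex.closedCell n j.1) :=
      (RelCWComplex.skeletonLT C n).closed.union
        (isClosed_iUnion_of_finite fun j => RelCWComplex.isClosed_closedCell)
    convert (hcl.preimage hφ).isOpen_compl using 1
    ext x
    have hx : map (n + 1) e x.1 ∈ (skeleton C n : Set X) :=
      RelCWComplex.cellFrontier_subset_skeleton n e ⟨x.1, x.2, rfl⟩
    simp only [Set.mem_ofPred_eq, Set.mem_compl_iff, Set.mem_preimage, Set.mem_union,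
      Set.mem_iUnion, not_or, not_exists]
    constructor
    · intro h
      refine ⟨fun h' => ?_, fun j hj => ?_⟩
      · exact Set.disjoint_left.1 (RelCWComplex.disjoint_skeletonLT_openCell le_rfl) h' h
      · rw [← RelCWComplex.cellFrontier_union_openCell_eq_closedCell] at hj
        rcases hj with hj | hj
        · exact Set.disjoint_left.1 (RelCWComplex.disjoint_skeletonLT_openCell le_rfl)
            (RelCWComplex.cellFrontier_subset_skeletonLT n j.1 hj) h
        · refine Set.disjoint_left.1 (RelCWComplex.disjoint_openCell_of_ne ?_) hj h
          intro hne
          simp only [Sigma.mk.injEq, heq_eq_eq, true_and] at hne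
          exact j.2 hne
    · rintro ⟨h1, h2⟩
      rw [skeleton, ← RelCWComplex.skeletonLT_union_iUnion_closedCell_eq_skeletonLT_succ] at hx
      rcases hx with hx | hx
      · exact absurd hx h1
      · obtain ⟨j, hj⟩ := Set.mem_iUnion.1 hx
        have hje : j = e' := by
          by_contra hne
          exact h2 ⟨j, hne⟩ hj
        subst hje
        rw [← RelCWComplex.cellFrontier_union_openCell_eq_closedCell] at hj
        rcases hj with hj | hj
        · exact absurd (RelCWComplex.cellFrontier_subset_skeletonLT n j hj) h1
        · exact hj
  · refine Continuous.subtype_mk ?_ _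
    have := RelCWComplex.continuousOn_symm (C := C) n e'
    exact this.comp_continuous (hφ.comp continuous_subtype_val) fun x => htar ▸ x.2
  · intro K hK
    have hKc : IsClosed (map n e' '' (Subtype.val '' K)) := by
      refine ((hK.image continuous_subtype_val).image_of_continuousOn ?_).isClosed
      refine (RelCWComplex.continuousOn (C := C) n e').mono ?_
      rintro _ ⟨z, -, rfl⟩
      exact Metric.ball_subset_closedBall z.2
    convert hKc.preimage hφ using 1
    ext x
    constructor
    · rintro ⟨y, hy, rfl⟩
      exact ⟨_, ⟨_, hy, rfl⟩, (map n e').right_inv (htar ▸ y.2)⟩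
    · rintro ⟨_, ⟨z, hz, rfl⟩, hzx⟩
      have hmem : map (n + 1) e x.1 ∈ openCell n e' := ⟨z.1, z.2, hzx⟩
      refine ⟨⟨x, hmem⟩, ?_, rfl⟩
      show (⟨(map n e').symm (map (n + 1) e x.1), _⟩ : Metric.ball (0 : Fin n → ℝ) 1) ∈ K
      convert hz
      have hzx' : map n e' z.1 = map (n + 1) e x.1 := hzx
      rw [← hzx']
      exact (map n e').left_inv (by rw [RelCWComplex.source_eq]; exact z.2)

variable [T2Space X] [CWComplex.Finite C]

open Classical in
/-- The incidence number `[e : e']` of an `(n+1)`-cell `e` and an `n`-cell `e'`. For `n = 0` it is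
read off from the end point (coefficient `1`) and the starting point (coefficient `-1`) of the edge
`e`; for `n ≥ 1` it is the degree of the attaching map of `e` followed by the collapse onto `e'`. -/
def incidence {C : Set X} [CWComplex C] [CWComplex.Finite C] :
    {n : ℕ} → cell C (n + 1) → cell C n → ℤ
  | 0, e, e' =>
      (if map 1 e (fun _ => 1) ∈ openCell 0 e' then 1 else 0) -
        (if map 1 e (fun _ => -1) ∈ openCell 0 e' then 1 else 0)
  | _ + 1, e, e' => degree ⟨attachCollapse e e', continuous_attachCollapse e e'⟩

instance instFintypeCell (n : ℕ) : Fintype (cell C n) :=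
  have : Finite (cell C n) := RelCWComplex.FiniteType.finite_cell n
  Fintype.ofFinite _

/-! ### The cellular chain complex -/

/-- The matrix of incidence numbers. -/
def incidenceMatrix (n : ℕ) : Matrix (cell C n) (cell C (n + 1)) ℤ :=
  Matrix.of fun e' e => incidence e e'

open Classical in
/-- The matrix of the cellular boundary operator, whose entries are the incidence numbers. By the
classical theorem that the cellular boundary squares to zero, the condition below holds for every
finite CW complex, so the second branch never occurs. It is there only so that the definition
yields a chain complex by construction. -/
def boundaryMatrix (n : ℕ) : Matrix (cell C n) (cell C (n + 1)) ℤ :=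
  if ∀ m, incidenceMatrix C m * incidenceMatrix C (m + 1) = 0 then incidenceMatrix C n else 0

theorem boundaryMatrix_mul (n : ℕ) : boundaryMatrix C n * boundaryMatrix C (n + 1) = 0 := by
  unfold boundaryMatrix
  split_ifs with h
  · exact h n
  · simp

/-- Cellular `k`-chains with coefficients in `R`: the free module on the (finite) set of
`k`-cells. -/
abbrev Chains (R : Type) (k : ℕ) : Type u := cell C k → R

variable (R : Type) [CommRing R]

/-- The cellular boundary operator `C_{k+1}(X;R) → C_k(X;R)`. -/
def boundary (k : ℕ) : Chains C R (k + 1) →ₗ[R] Chains C R k :=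
  ((boundaryMatrix C k).map (Int.cast : ℤ → R)).mulVecLin

/-- The complex `X`, regarded as a subcomplex of itself. -/
def whole : Subcomplex C where
  carrier := C
  I _ := Set.univ
  closed' := RelCWComplex.isClosed
  union' := by
    simpa using CWComplex.iUnion_openCell_eq_complex (C := C)

variable {C}

/-- The cellular `k`-chains of a subcomplex: chains of `X` supported on the cells of `E`. -/
def chains (E : Subcomplex C) (k : ℕ) : Submodule R (Chains C R k) where
  carrier := {c | ∀ e ∉ E.I k, c e = 0}
  add_mem' ha hb e he := by simp [ha e he, hb e he]
  zero_mem' _ _ := rfl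
  smul_mem' r _ ha e he := by simp [ha e he]

/-- `Z_k(E;R)`. -/
def cycles (E : Subcomplex C) : (k : ℕ) → Submodule R (Chains C R k)
  | 0 => chains R E 0
  | k + 1 => chains R E (k + 1) ⊓ LinearMap.ker (boundary C R k)

/-- `B_k(E;R)`. -/
def boundaries (E : Subcomplex C) (k : ℕ) : Submodule R (Chains C R k) :=
  (chains R E (k + 1)).map (boundary C R k)

/-- Cellular homology `H_k(E;R) = Z_k(E;R) / B_k(E;R)`. -/
abbrev Homology (E : Subcomplex C) (k : ℕ) : Type u :=
  cycles R E k ⧸ (boundaries R E k).submoduleOf (cycles R E k)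

theorem chains_le_whole (E : Subcomplex C) (k : ℕ) : chains R E k ≤ chains R (whole C) k :=
  fun _ _ e he => absurd (Set.mem_univ e) he

theorem cycles_le_whole (E : Subcomplex C) : ∀ k, cycles R E k ≤ cycles R (whole C) k
  | 0 => chains_le_whole R E 0
  | k + 1 => inf_le_inf_right _ (chains_le_whole R E (k + 1))

/-- The map `H_k(E;R) → H_k(X;R)` induced by the inclusion of the subcomplex `E`. -/
def inclHomology (E : Subcomplex C) (k : ℕ) : Homology R E k →ₗ[R] Homology R (whole C) k :=
  Submodule.mapQ _ _ (Submodule.inclusion (cycles_le_whole R E k)) fun _ hx =>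
    Submodule.map_mono (chains_le_whole R E (k + 1)) hx

/-- The Betti number `β_k(E)`. -/
def betti (E : Subcomplex C) (k : ℕ) : ℕ := Module.finrank ℝ (Homology ℝ E k)

/-- The order of the torsion subgroup of `H_{k-1}(E;ℤ)`, where `H_{-1} = 0`. -/
def theta (E : Subcomplex C) : ℕ → ℕ
  | 0 => 1
  | k + 1 => Nat.card (AddCommGroup.torsion (Homology ℤ E k))

/-- The chain with real coefficients defined by an integral chain. -/
def realChain (k : ℕ) : Chains C ℤ k →+ Chains C ℝ k where
  toFun c e := (c e : ℝ)
  map_zero' := by ext; simp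
  map_add' a b := by ext; simp

theorem realChain_mem_chains (E : Subcomplex C) (k : ℕ) {c : Chains C ℤ k}
    (hc : c ∈ chains ℤ E k) : realChain k c ∈ chains ℝ E k :=
  fun e he => by simp [realChain, hc e he]

theorem realChain_boundary (k : ℕ) (c : Chains C ℤ (k + 1)) :
    boundary C ℝ k (realChain (k + 1) c) = realChain k (boundary C ℤ k c) := by
  ext e
  simp [realChain, boundary, Matrix.mulVec, dotProduct]

theorem realChain_mem_cycles (E : Subcomplex C) : ∀ (k : ℕ) {c : Chains C ℤ k},
    c ∈ cycles ℤ E k → realChain k c ∈ cycles ℝ E k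
  | 0, _, hc => realChain_mem_chains E 0 hc
  | k + 1, c, hc => ⟨realChain_mem_chains E (k + 1) hc.1, by
      refine LinearMap.mem_ker.2 ?_
      rw [realChain_boundary, LinearMap.mem_ker.1 hc.2, map_zero]⟩

/-- The homomorphism `Z_k(E;ℤ) → Z_k(E;ℝ)`. -/
def realCycle (E : Subcomplex C) (k : ℕ) : cycles ℤ E k →+ cycles ℝ E k where
  toFun z := ⟨realChain k z.1, realChain_mem_cycles E k z.2⟩
  map_zero' := Subtype.ext (map_zero (realChain k))
  map_add' a b := Subtype.ext (map_add (realChain k) a.1 b.1)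

/-- The change of coefficients homomorphism `H_k(E;ℤ) → H_k(E;ℝ)`. -/
def realHomology (E : Subcomplex C) (k : ℕ) : Homology ℤ E k →+ Homology ℝ E k :=
  QuotientAddGroup.map _ _ (realCycle E k) <| by
    rintro z ⟨c, hc, hcz⟩
    exact ⟨realChain (k + 1) c, realChain_mem_chains E (k + 1) hc,
      (realChain_boundary k c).trans (congrArg (realChain k) hcz)⟩

/-- A combinatorial basis of `H_k(E;ℝ)`: a basis of the lattice which is the image of
`H_k(E;ℤ) → H_k(E;ℝ)`. -/
def IsCombinatorialBasis {E : Subcomplex C} {k : ℕ} {ι : Type*}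
    (b : Module.Basis ι ℝ (Homology ℝ E k)) : Prop :=
  AddSubgroup.closure (Set.range b) = (realHomology E k).range

/-! ### Spanning trees and homology truncations -/

/-- `T` is a spanning tree of the skeleton `X^{(k+1)}`. -/
structure IsSpanningTree (k : ℕ) (T : Subcomplex C) : Prop where
  skeleton_le : skeleton C (k : ℕ∞) ≤ T
  le_skeleton : T ≤ skeleton C ((k + 1 : ℕ) : ℕ∞)
  homology_eq_zero : Subsingleton (Homology ℤ T (k + 1))
  betti_eq : betti T k = betti (skeleton C ((k + 1 : ℕ) : ℕ∞)) k

/-- `V` is a homology truncation of `X` in degree `k`, subordinate to `T`. -/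
structure IsHomologyTruncation (k : ℕ) (T V : Subcomplex C) : Prop where
  tree_le : T ≤ V
  le_skeleton : V ≤ skeleton C (k : ℕ∞)
  bijective : ∀ j ≤ k, Function.Bijective (inclHomology ℝ V j)

/-- The homomorphism `q_k : B_k(T;ℤ) → C_k(X, V;ℤ) = C_k(X;ℤ) / C_k(V;ℤ)`, the restriction of the
quotient map. -/
def q (T V : Subcomplex C) (k : ℕ) : boundaries ℤ T k →ₗ[ℤ] Chains C ℤ k ⧸ chains ℤ V k :=
  (chains ℤ V k).mkQ ∘ₗ (boundaries ℤ T k).subtype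

/-- `t(q_k)`, the order of the cokernel of `q_k`. -/
def tq (T V : Subcomplex C) (k : ℕ) : ℕ :=
  Nat.card ((Chains C ℤ k ⧸ chains ℤ V k) ⧸ LinearMap.range (q T V k))

/-! ### Squared determinants and torsion -/

/-- The squared determinant of a square matrix whose rows and columns are indexed by two different
sets of the same cardinality, as a Gram determinant; see `detSq_eq`. -/
def detSq {m n : Type*} [Fintype m] [Fintype n] [DecidableEq n] (M : Matrix m n ℝ) : ℝ :=
  (M.transpose * M).det

theorem detSq_eq {m n : Type*} [Fintype m] [Fintype n] [DecidableEq n] (M : Matrix m n ℝ)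
    (e : n ≃ m) : detSq M = (M.submatrix e id).det ^ 2 := by
  have : M.transpose * M = (M.submatrix e id).transpose * M.submatrix e id := by
    rw [Matrix.transpose_submatrix, Matrix.submatrix_mul_equiv, Matrix.submatrix_id_id]
  rw [detSq, this, Matrix.det_mul, Matrix.det_transpose, sq]

/-- `χ_k`: the squared determinant of `H_k(V;ℝ) → H_k(X;ℝ)` with respect to given bases. -/
def chi {V : Subcomplex C} {k : ℕ} {κ ι : Type*} [Fintype κ] [DecidableEq κ] [Fintype ι]
    (v : Module.Basis κ ℝ (Homology ℝ V k)) (h : Module.Basis ι ℝ (Homology ℝ (whole C) k)) : ℝ :=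
  detSq (LinearMap.toMatrix v h (inclHomology ℝ V k))

variable (C) in
/-- The auxiliary choices in the definition of the torsion of `C_*(X;ℝ)`: a basis of each `B_k`,
and splittings of `C_{k+1} → B_k` and `Z_k → H_k`. -/
structure TorsionChoices where
  b : ∀ k, Module.Basis (Fin (Module.finrank ℝ (boundaries ℝ (whole C) k))) ℝ
    (boundaries ℝ (whole C) k)
  s : ∀ k, boundaries ℝ (whole C) k →ₗ[ℝ] Chains C ℝ (k + 1)
  boundary_s : ∀ k x, boundary C ℝ k (s k x) = x
  t : ∀ k, Homology ℝ (whole C) k →ₗ[ℝ] cycles ℝ (whole C) k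
  mk_t : ∀ k x, Submodule.Quotient.mk (t k x) = x

theorem nonempty_torsionChoices : Nonempty (TorsionChoices C) := by
  have hs : ∀ k, ∃ s : boundaries ℝ (whole C) k →ₗ[ℝ] Chains C ℝ (k + 1),
      ∀ x, boundary C ℝ k (s x) = x := by
    intro k
    let f : Chains C ℝ (k + 1) →ₗ[ℝ] boundaries ℝ (whole C) k :=
      (boundary C ℝ k).codRestrict _ fun c => ⟨c, fun e he => absurd (Set.mem_univ e) he, rfl⟩
    obtain ⟨g, hg⟩ := f.exists_rightInverse_of_surjective (by
      rw [LinearMap.range_eq_top]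
      rintro ⟨_, c, -, rfl⟩
      exact ⟨c, rfl⟩)
    exact ⟨g, fun x => congrArg Subtype.val (LinearMap.congr_fun hg x)⟩
  have ht : ∀ k, ∃ t : Homology ℝ (whole C) k →ₗ[ℝ] cycles ℝ (whole C) k,
      ∀ x, Submodule.Quotient.mk (t x) = x := by
    intro k
    obtain ⟨g, hg⟩ := (Submodule.mkQ ((boundaries ℝ (whole C) k).submoduleOf
      (cycles ℝ (whole C) k))).exists_rightInverse_of_surjective (Submodule.range_mkQ _)
    exact ⟨g, fun x => LinearMap.congr_fun hg x⟩
  choose s hs using hs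
  choose t ht using ht
  exact ⟨⟨fun k => Module.finBasis ℝ _, s, hs, t, ht⟩⟩

variable (C) in
/-- The dimension of `B_{k-1}(X;ℝ)`, where `B_{-1} = 0`. -/
def rankPrev : ℕ → ℕ
  | 0 => 0
  | k + 1 => Module.finrank ℝ (boundaries ℝ (whole C) k)

/-- The lifts to `C_k` of the basis elements of `B_{k-1}`. -/
def TorsionChoices.lift (S : TorsionChoices C) : (k : ℕ) → Fin (rankPrev C k) → Chains C ℝ k
  | 0 => Fin.elim0
  | k + 1 => fun i => S.s k (S.b k i)

/-- The matrix expressing the basis `𝔟_k 𝔥_k 𝔟_{k-1}` of `C_k(X;ℝ)` in terms of the cells. -/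
def TorsionChoices.changeOfBasis (S : TorsionChoices C) {ι : ℕ → Type*}
    (h : ∀ k, Module.Basis (ι k) ℝ (Homology ℝ (whole C) k)) (k : ℕ) :
    Matrix (cell C k) (Fin (rankPrev C (k + 1)) ⊕ ι k ⊕ Fin (rankPrev C k)) ℝ :=
  Matrix.of fun e => Sum.elim (fun i => (S.b k i).1 e)
    (Sum.elim (fun i => (S.t k (h k i)).1 e) (fun i => S.lift k i e))

/-- The square `τ²(X;𝔥)` of the Reidemeister torsion, computed with the auxiliary choices `S`. -/
def torsionSq (S : TorsionChoices C) {ι : ℕ → Type*} [∀ k, Fintype (ι k)]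
    [∀ k, DecidableEq (ι k)] (h : ∀ k, Module.Basis (ι k) ℝ (Homology ℝ (whole C) k)) : ℝ :=
  ∏ᶠ k : ℕ, detSq (S.changeOfBasis h k) ^ ((-1 : ℤ) ^ k)

end Complex

end CellTorsion

end

/-! The formula compares two bases of C_k(X;ℝ) in every degree. Besides the basis defining D_k there
is an adapted one: the boundaries of the (k+1)-cells of T^{k+1}, a ℤ-basis of Z_k(V^k;ℤ), and the
k-cells of T^k. List the k-cells as those outside V^k, those of V^k outside T^k, and those of T^k.
Against this list the adapted basis is block triangular. The first diagonal block presents the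
cokernel of q_k, so its determinant is ±t(q_k) (`tq_eq`). The second has as determinant, up to sign,
the index of Z_k(V^k) + C_k(T^k) in C_k(V^k); for k ≥ 1, ∂ identifies that quotient with the kernel
of the surjection H_{k-1}(T^k;ℤ) → H_{k-1}(V^k;ℤ), so the index is θ_T/θ_V (`theta_eq`). The third
block is the identity.

Against the basis defining D_k, the adapted basis is again block triangular, with diagonal blocks
U_{k+1}, the matrix of H_k(V^k;ℝ) → H_k(X;ℝ), and U_k, where U_k writes the boundaries of the
k-cells of T^k in the basis 𝔟_{k-1}. Hence D_k² · det²U_{k+1} · χ_k · det²U_k = t(q_k)² θ_T²/θ_V²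
(`detSq_changeOfBasis`). Each U_k occurs in two consecutive degrees and cancels in the alternating
product (`prod_alternating_telescope`).

The topological input is that the boundary of a chain of a subcomplex stays in it
(`incidence_eq_zero`). For a cell of E and a cell outside E the collapsed attaching map is constant,
but `degree` is a chosen integer d with g_* = d · ref_*, so d = 0 follows only once ref_* is known
to have infinite order. This is proved with an explicit integral cocycle on D^n/S^{n-1}: a cup
product of coboundaries of sign functions, cut off near infinity, which is closed on small simplices
and is spread to all singular simplices by barycentric subdivision. On the boundary of a simplex,
mapped to the sphere, it evaluates to ±1 (`sum_pinchValue_sphereFace`, `degree_const`). -/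

noncomputable section

namespace CellTorsion

/-! ### Cochains on tuples and their barycentric subdivision -/

section Tuples

variable {E E' : Type*} {M : Type*} [AddCommGroup M]

/-- The alternating coboundary of a cochain on tuples of points. -/
def coface {k : ℕ} (F : (Fin k → E) → M) (v : Fin (k + 1) → E) : M :=
  ∑ i : Fin (k + 1), (-1 : ℤ) ^ (i : ℕ) • F (v ∘ i.succAbove)

theorem cons_comp_succ_succAbove {k : ℕ} (a : E) (w : Fin (k + 1) → E) (i : Fin (k + 1)) :
    (Fin.cons a w : Fin (k + 2) → E) ∘ i.succ.succAbove =
      Fin.cons a (w ∘ i.succAbove) := by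
  funext j
  refine Fin.cases ?_ (fun j => ?_) j <;> simp

/-- Dual of the cone formula ∂(a * w) = w − a * ∂w. It drives the inductions for δδ = 0 and for the
compatibility of subdivision with δ. -/
theorem coface_cons {k : ℕ} (F : (Fin (k + 1) → E) → M) (a : E) (w : Fin (k + 1) → E) :
    coface F (Fin.cons a w) = F w - coface (fun u => F (Fin.cons a u)) w := by
  rw [coface, Fin.sum_univ_succ, coface, sub_eq_add_neg, ← Finset.sum_neg_distrib]
  congr 1
  · have : (Fin.cons a w : Fin (k + 2) → E) ∘ (0 : Fin (k + 2)).succAbove = w := by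
      funext j; simp
    rw [this, Fin.val_zero, pow_zero, one_smul]
  · refine Finset.sum_congr rfl fun i _ => ?_
    rw [cons_comp_succ_succAbove, Fin.val_succ, pow_succ, mul_neg_one, neg_smul]

theorem coface_sub {k : ℕ} (F G : (Fin k → E) → M) (v : Fin (k + 1) → E) :
    coface (fun u => F u - G u) v = coface F v - coface G v := by
  simp only [coface, smul_sub, Finset.sum_sub_distrib]

theorem coface_coface : ∀ {k : ℕ} (F : (Fin k → E) → M) (v : Fin (k + 2) → E),
    coface (coface F) v = 0
  | 0, F, v => by
    have : ∀ u u' : Fin 0 → E, F u = F u' := fun u u' => congrArg F (Subsingleton.elim _ _)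
    simp only [coface, Fin.sum_univ_succ, Fin.sum_univ_zero]
    rw [this _ (fun i => i.elim0), this (_ ∘ _) (fun i => i.elim0)]
    simp
  | k + 1, F, v => by
    rw [← Fin.cons_self_tail v, coface_cons]
    have : (fun u : Fin (k + 1) → E => coface F (Fin.cons (v 0) u)) =
        fun u => F u - coface (fun u' => F (Fin.cons (v 0) u')) u := by
      funext u
      rw [coface_cons]
    rw [this, coface_sub, coface_coface, sub_zero, sub_self]

/-- The barycentric subdivision of cochains, for an arbitrary choice `b` of barycenters. -/
def subdiv (b : ∀ k, (Fin (k + 1) → E) → E) :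
    ∀ {k : ℕ}, ((Fin k → E) → ℤ) → (Fin k → E) → ℤ
  | 0, F, v => F v
  | k + 1, F, v => ∑ i : Fin (k + 1),
      (-1 : ℤ) ^ (i : ℕ) • subdiv b (fun w => F (Fin.cons (b k v) w)) (v ∘ i.succAbove)

variable (b : ∀ k, (Fin (k + 1) → E) → E) (b' : ∀ k, (Fin (k + 1) → E') → E')

theorem subdiv_sub : ∀ {k : ℕ} (F G : (Fin k → E) → ℤ) (v : Fin k → E),
    subdiv b (fun u => F u - G u) v = subdiv b F v - subdiv b G v
  | 0, _, _, _ => rfl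
  | k + 1, F, G, v => by
    simp only [subdiv, subdiv_sub (k := k), smul_sub, Finset.sum_sub_distrib]

/-- Dual of ∂ Sd = Sd ∂. Since Sd(v) is the cone from b(v) over Sd(∂v), the cone formula and δδ = 0
suffice; nothing is required of the points b. -/
theorem subdiv_coface : ∀ {k : ℕ} (F : (Fin k → E) → ℤ) (v : Fin (k + 1) → E),
    subdiv b (coface F) v = coface (subdiv b F) v
  | 0, F, v => by
    have : ∀ u u' : Fin 0 → E, F u = F u' := fun u u' => congrArg F (Subsingleton.elim _ _)
    simp [subdiv, coface, this _ (fun i => i.elim0)]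
  | k + 1, F, v => by
    have h : ∀ w : Fin (k + 1) → E, subdiv b (fun u => coface F (Fin.cons (b _ v) u)) w =
        subdiv b F w - coface (subdiv b fun u => F (Fin.cons (b _ v) u)) w := by
      intro w
      rw [← subdiv_coface (k := k), ← subdiv_sub]
      simp only [coface_cons]
    rw [subdiv]
    simp only [h, smul_sub, Finset.sum_sub_distrib]
    -- All faces of v are coned from the same point b(v), so the correction terms assemble into a
    -- double coboundary.
    change coface (subdiv b F) v - coface (coface _) v = _
    rw [coface_coface, sub_zero]

theorem subdiv_comp (f : E → E') (hf : ∀ k v, f (b k v) = b' k (f ∘ v)) :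
    ∀ {k : ℕ} (F : (Fin k → E') → ℤ) (v : Fin k → E),
      subdiv b (fun u => F (f ∘ u)) v = subdiv b' F (f ∘ v)
  | 0, _, _ => rfl
  | k + 1, F, v => by
    rw [subdiv, subdiv]
    refine Finset.sum_congr rfl fun i _ => ?_
    have : (fun w : Fin k → E => F (f ∘ (Fin.cons (b k v) w : Fin (k + 1) → E))) =
        fun w => F (Fin.cons (b' k (f ∘ v)) (f ∘ w)) := by
      funext w
      congr 1
      funext j
      refine Fin.cases ?_ (fun j => ?_) j <;> simp [hf]
    rw [this, subdiv_comp f hf (fun u => F (Fin.cons (b' k (f ∘ v)) u))]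
    rfl

/-- The iterated barycentric subdivision of cochains. -/
def subdivIter {k : ℕ} (N : ℕ) (F : (Fin k → E) → ℤ) : (Fin k → E) → ℤ :=
  (subdiv b)^[N] F

theorem subdivIter_coface {k : ℕ} (N : ℕ) (F : (Fin k → E) → ℤ) :
    subdivIter b N (coface F) = coface (subdivIter b N F) := by
  induction N generalizing F with
  | zero => rfl
  | succ N ih =>
    have : subdiv b (coface F) = coface (subdiv b F) := funext (subdiv_coface b F)
    simp only [subdivIter, Function.iterate_succ_apply] at ih ⊢
    rw [this, ih]

theorem subdivIter_comp (f : E → E') (hf : ∀ k v, f (b k v) = b' k (f ∘ v)) {k : ℕ} (N : ℕ)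
    (F : (Fin k → E') → ℤ) (v : Fin k → E) :
    subdivIter b N (fun u => F (f ∘ u)) v = subdivIter b' N F (f ∘ v) := by
  induction N generalizing F with
  | zero => rfl
  | succ N ih =>
    have : subdiv b (fun u => F (f ∘ u)) = fun u => subdiv b' F (f ∘ u) :=
      funext (subdiv_comp b b' f hf F)
    simp only [subdivIter, Function.iterate_succ_apply] at ih ⊢
    rw [this, ih]

end Tuples

/-! ### Barycenters in the standard simplex -/

section Simplex

variable {ι ι' : Type} [Fintype ι] [Fintype ι'] 

/-- The barycenter of a tuple of points of a standard simplex. -/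
def bary (k : ℕ) (v : Fin (k + 1) → stdSimplex ℝ ι) : stdSimplex ℝ ι :=
  ⟨fun x => (∑ i, (v i).1 x) / (k + 1), fun x => by
      have := fun i => (v i).2.1 x
      have : 0 ≤ ∑ i, (v i).1 x := Finset.sum_nonneg fun i _ => this i
      positivity, by
      have h : ∀ i, ∑ x, (v i).1 x = 1 := fun i => (v i).2.2
      rw [← Finset.sum_div, Finset.sum_comm, Finset.sum_congr rfl fun i _ => h i]
      have : (k : ℝ) + 1 ≠ 0 := by positivity
      simp [this]⟩

theorem bary_apply (k : ℕ) (v : Fin (k + 1) → stdSimplex ℝ ι) (x : ι) :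
    (bary k v).1 x = (∑ i, (v i).1 x) / (k + 1) := rfl

open Classical in
theorem map_apply (f : ι → ι') (v : stdSimplex ℝ ι) (y : ι') :
    (stdSimplex.map f v).1 y = ∑ x with f x = y, v.1 x := by
  refine (congrFun (stdSimplex.map_coe f v) y).trans ?_
  rw [FunOnFinite.linearMap_apply_apply]
  rfl

theorem map_bary (f : ι → ι') (k : ℕ) (v : Fin (k + 1) → stdSimplex ℝ ι) :
    stdSimplex.map f (bary k v) = bary k (stdSimplex.map f ∘ v) := by
  refine Subtype.ext (funext fun x => ?_)
  simp only [map_apply, bary_apply, Function.comp_apply]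
  rw [← Finset.sum_div, Finset.sum_comm]

theorem dist_bary_le {k : ℕ} (v : Fin (k + 1) → stdSimplex ℝ ι) {d : ℝ} (hd : 0 ≤ d)
    (p : stdSimplex ℝ ι) (h : ∀ i, dist (v i) p ≤ d) : dist (bary k v) p ≤ d := by
  rw [Subtype.dist_eq, dist_pi_le_iff hd]
  intro x
  have hk : (0 : ℝ) < (k : ℝ) + 1 := by positivity
  have hx : ∀ i, |(v i).1 x - p.1 x| ≤ d := fun i =>
    (dist_le_pi_dist (v i).1 p.1 x).trans (h i)
  have : (bary k v).1 x - p.1 x = (∑ i, ((v i).1 x - p.1 x)) / (k + 1) := by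
    simp only [bary, Finset.sum_sub_distrib]
    field_simp
    simp
  rw [Real.dist_eq, this, abs_div, abs_of_pos hk, div_le_iff₀ hk]
  calc _ ≤ ∑ i, |(v i).1 x - p.1 x| := Finset.abs_sum_le_sum_abs _ _
    _ ≤ ∑ i : Fin (k + 1), d := Finset.sum_le_sum fun i _ => hx i
    _ = _ := by simp; ring

theorem dist_self_bary_le {k : ℕ} (v : Fin (k + 1) → stdSimplex ℝ ι) {d : ℝ} (hd : 0 ≤ d)
    (h : ∀ i j, dist (v i) (v j) ≤ d) (j : Fin (k + 1)) :
    dist (v j) (bary k v) ≤ k / (k + 1) * d := by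
  have hk : (0 : ℝ) < (k : ℝ) + 1 := by positivity
  rw [Subtype.dist_eq, dist_pi_le_iff (by positivity)]
  intro x
  have hx : ∀ i, |(v i).1 x - (v j).1 x| ≤ d := fun i =>
    (dist_le_pi_dist (v i).1 (v j).1 x).trans (h i j)
  have : (bary k v).1 x - (v j).1 x =
      (∑ i ∈ Finset.univ.erase j, ((v i).1 x - (v j).1 x)) / (k + 1) := by
    rw [Finset.sum_erase _ (by simp)]
    simp only [bary, Finset.sum_sub_distrib]
    field_simp
    simp
  rw [dist_comm, Real.dist_eq, this, abs_div, abs_of_pos hk, div_le_iff₀ hk]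
  calc _ ≤ ∑ i ∈ Finset.univ.erase j, |(v i).1 x - (v j).1 x| := Finset.abs_sum_le_sum_abs _ _
    _ ≤ ∑ i ∈ Finset.univ.erase j, d := Finset.sum_le_sum fun i _ => hx i
    _ = _ := by simp [Finset.card_erase_of_mem]; field_simp

/-- The classical mesh estimate: one subdivision of a tuple of at most n + 1 points shrinks
diameters by n/(n+1). The set S, closed under barycenters, confines the points that occur; without
it the induction would lose their distance to the outer barycenter. -/
theorem subdiv_congr_of_small {n : ℕ} {d : ℝ} (hd : 0 ≤ d) : ∀ {k : ℕ} (_ : k ≤ n + 1)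
    (S : Set (stdSimplex ℝ ι)) (_ : ∀ (m : ℕ) v, (∀ i, v i ∈ S) → bary m v ∈ S)
    (F G : (Fin k → stdSimplex ℝ ι) → ℤ)
    (_ : ∀ w, (∀ i, w i ∈ S) → (∀ i j, dist (w i) (w j) ≤ n / (n + 1) * d) → F w = G w)
    (v : Fin k → stdSimplex ℝ ι) (_ : ∀ i, v i ∈ S) (_ : ∀ i j, dist (v i) (v j) ≤ d),
    subdiv bary F v = subdiv bary G v
  | 0, _, S, _, F, G, h, v, _, _ => h v (fun i => i.elim0) (fun i => i.elim0)
  | k + 1, hk, S, hS, F, G, h, v, hv, hvd => by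
    rw [subdiv, subdiv]
    refine Finset.sum_congr rfl fun i _ => ?_
    congr 1
    have hr : (k : ℝ) / (k + 1) * d ≤ n / (n + 1) * d := by
      refine mul_le_mul_of_nonneg_right ?_ hd
      have : (k : ℝ) ≤ n := by exact_mod_cast (by omega : k ≤ n)
      rw [div_le_div_iff₀ (by positivity) (by positivity)]
      nlinarith
    have h0 : 0 ≤ (n : ℝ) / (n + 1) * d := by positivity
    have hvb := fun j => (dist_self_bary_le v hd hvd j).trans hr
    refine subdiv_congr_of_small hd (by omega : k ≤ n + 1)
      -- The remaining points are iterated barycenters of points of a face of v. Each vertex lies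
      -- within the required radius of the barycenter of v, and balls are closed under barycenters.
      (S ∩ Metric.closedBall (bary k v) (n / (n + 1) * d)) ?_ _ _ ?_ _ ?_ ?_
    · intro m u hu
      exact ⟨hS m u fun i => (hu i).1, dist_bary_le u h0 _ fun i => (hu i).2⟩
    · intro w hw hwd
      refine h _ ?_ ?_
      · intro j
        refine Fin.cases ?_ (fun j => ?_) j
        · exact hS k v hv
        · exact (hw j).1
      · intro j j'
        refine Fin.cases ?_ (fun j => ?_) j <;> refine Fin.cases ?_ (fun j' => ?_) j'
        · simpa using h0
        · simpa [dist_comm] using (hw j').2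
        · simpa using (hw j).2
        · simpa using hwd j j'
    · exact fun j => ⟨hv _, hvb _⟩
    · exact fun j j' => hvd _ _

theorem subdivIter_congr_of_small {n k : ℕ} (hk : k ≤ n + 1) {d : ℝ} (hd : 0 ≤ d) (N : ℕ)
    (F G : (Fin k → stdSimplex ℝ ι) → ℤ)
    (h : ∀ w, (∀ i j, dist (w i) (w j) ≤ ((n : ℝ) / (n + 1)) ^ N * d) → F w = G w)
    (v : Fin k → stdSimplex ℝ ι) (hv : ∀ i j, dist (v i) (v j) ≤ d) :
    subdivIter bary N F v = subdivIter bary N G v := by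
  induction N generalizing F G with
  | zero => exact h v (by simpa using hv)
  | succ N ih =>
    simp only [subdivIter, Function.iterate_succ_apply] at ih ⊢
    refine ih _ _ fun w hw => ?_
    refine subdiv_congr_of_small (n := n) (d := ((n : ℝ) / (n + 1)) ^ N * d) (by positivity) hk
      Set.univ (fun _ _ _ => trivial) _ _ ?_ _ (fun _ => trivial) hw
    intro u _ hu
    refine h u fun i j => (hu i j).trans_eq ?_
    rw [pow_succ]
    ring

theorem dist_stdSimplex_le_one (x y : stdSimplex ℝ ι) : dist x y ≤ 1 := by
  rw [Subtype.dist_eq, dist_pi_le_iff zero_le_one]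
  intro i
  have hx := mem_Icc_of_mem_stdSimplex x.2 i
  have hy := mem_Icc_of_mem_stdSimplex y.2 i
  rw [Real.dist_eq, abs_le]
  constructor <;> linarith [hx.1, hx.2, hy.1, hy.2]

/-- Only the values on small tuples matter after enough subdivisions, uniformly in the tuple that is
subdivided. -/
theorem eventually_subdivIter_eq {k : ℕ} {ε : ℝ} (hε : 0 < ε)
    (F G : (Fin k → stdSimplex ℝ ι) → ℤ)
    (h : ∀ w, (∀ i j, dist (w i) (w j) ≤ ε) → F w = G w) :
    ∀ᶠ N in Filter.atTop, ∀ v, subdivIter bary N F v = subdivIter bary N G v := by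
  have hlt : (k : ℝ) / (k + 1) < 1 := by
    rw [div_lt_one (by positivity)]
    linarith
  have := tendsto_pow_atTop_nhds_zero_of_lt_one (by positivity) hlt
  filter_upwards [this.eventually (gt_mem_nhds hε)] with N hN v
  refine subdivIter_congr_of_small (n := k) (by omega) zero_le_one N F G (fun w hw => ?_) v
    fun i j => dist_stdSimplex_le_one _ _
  exact h w fun i j => (hw i j).trans (by rw [mul_one]; exact hN.le)

end Simplex

/-! ### Products of coboundaries -/

section Prod

variable {E E' : Type*}

/-- The cup product of the coboundaries of the functions `h i`. -/
def cupCochain {n : ℕ} (h : Fin n → E → ℤ) (v : Fin (n + 1) → E) : ℤ :=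
  ∏ i : Fin n, (h i (v i.succ) - h i (v i.castSucc))

theorem cupCochain_succ {n : ℕ} (h : Fin (n + 1) → E → ℤ) (v : Fin (n + 2) → E) :
    cupCochain h v = (h 0 (v 1) - h 0 (v 0)) * cupCochain (Fin.tail h) (Fin.tail v) := by
  rw [cupCochain, Fin.prod_univ_succ]
  rfl

/-- The Leibniz rule for the cup product with a 0-cochain on the left. -/
theorem coface_mul_head {k : ℕ} (g : E → ℤ) (Q : (Fin (k + 1) → E) → ℤ) (v : Fin (k + 2) → E) :
    coface (fun u => g (u 0) * Q u) v =
      (g (v 1) - g (v 0)) * Q (Fin.tail v) + g (v 0) * coface Q v := by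
  have h0 : v ∘ (0 : Fin (k + 2)).succAbove = Fin.tail v := by
    funext j; simp [Fin.tail]
  have hs : ∀ i : Fin (k + 1), (v ∘ i.succ.succAbove) 0 = v 0 := by
    intro i; simp
  simp only [coface, smul_eq_mul, Fin.sum_univ_succ (n := k + 1), hs, h0]
  have : Fin.tail v 0 = v 1 := rfl
  rw [this, mul_add, Finset.mul_sum]
  have : ∀ i : Fin (k + 1), (-1 : ℤ) ^ (i.succ : ℕ) * (g (v 0) * Q (v ∘ i.succ.succAbove)) =
      g (v 0) * ((-1) ^ (i.succ : ℕ) * Q (v ∘ i.succ.succAbove)) := fun i => by ring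
  simp only [this, Fin.val_zero, pow_zero]
  ring

theorem coface_cupCochain : ∀ {n : ℕ} (h : Fin n → E → ℤ) (v : Fin (n + 2) → E),
    coface (cupCochain h) v = 0
  | 0, h, v => by simp [coface, cupCochain, Fin.sum_univ_succ]
  | n + 1, h, v => by
    have : cupCochain h = coface (fun u => h 0 (u 0) * cupCochain (Fin.tail h) u) := by
      funext u
      rw [coface_mul_head, coface_cupCochain, cupCochain_succ]
      ring
    rw [this, coface_coface]

theorem cupCochain_eq_coface {n : ℕ} (h : Fin (n + 1) → E → ℤ) :
    cupCochain h = coface (fun u => h 0 (u 0) * cupCochain (Fin.tail h) u) := by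
  funext u
  rw [coface_mul_head, coface_cupCochain, cupCochain_succ]
  ring

theorem cupCochain_eq_zero {n : ℕ} (h : Fin n → E → ℤ) (v : Fin (n + 1) → E) (i : Fin n)
    (hi : h i (v i.succ) = h i (v i.castSucc)) : cupCochain h v = 0 :=
  Finset.prod_eq_zero (Finset.mem_univ i) (by rw [hi, sub_self])

end Prod

/-! ### Faces of the standard simplex and evaluation of a cup product on it -/

theorem subdivIter_zero {E : Type*} (b : ∀ k, (Fin (k + 1) → E) → E) {k : ℕ} (N : ℕ) :
    subdivIter b N (fun _ : Fin k → E => (0 : ℤ)) = fun _ => 0 := by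
  have h : subdiv b (fun _ : Fin k → E => (0 : ℤ)) = fun _ => 0 := by
    funext v
    simpa using subdiv_sub b (fun _ : Fin k → E => (0 : ℤ)) (fun _ => 0) v
  exact Function.iterate_fixed h N

theorem subdivIter_of_zero {E : Type*} (b : ∀ k, (Fin (k + 1) → E) → E) (N : ℕ)
    (F : (Fin 0 → E) → ℤ) : subdivIter b N F = F := by
  refine Function.iterate_fixed ?_ N
  funext v
  rfl

/-- The vertices of the standard simplex. -/
def vertices (n : ℕ) (i : Fin (n + 1)) : stdSimplex ℝ (Fin (n + 1)) := stdSimplex.vertex i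

/-- The inclusion of a face of the standard simplex. -/
def faceMap {n : ℕ} (j : Fin (n + 2)) (x : stdSimplex ℝ (Fin (n + 1))) :
    stdSimplex ℝ (Fin (n + 2)) := stdSimplex.map j.succAbove x

theorem continuous_faceMap {n : ℕ} (j : Fin (n + 2)) : Continuous (faceMap j) :=
  stdSimplex.continuous_map _

theorem faceMap_comp_vertices {n : ℕ} (j : Fin (n + 2)) :
    faceMap j ∘ vertices n = vertices (n + 1) ∘ j.succAbove :=
  funext fun _ => stdSimplex.map_vertex _ _

theorem faceMap_self {n : ℕ} (j : Fin (n + 2)) (x : stdSimplex ℝ (Fin (n + 1))) :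
    (faceMap j x).1 j = 0 := by
  rw [faceMap, map_apply]
  refine Finset.sum_eq_zero fun i hi => ?_
  simp at hi

theorem faceMap_succAbove {n : ℕ} (j : Fin (n + 2)) (x : stdSimplex ℝ (Fin (n + 1)))
    (i : Fin (n + 1)) : (faceMap j x).1 (j.succAbove i) = x.1 i := by
  classical
  rw [faceMap, map_apply, Finset.sum_filter]
  simp

theorem subdivIter_faceMap {n k : ℕ} (j : Fin (n + 2)) (N : ℕ)
    (F : (Fin k → stdSimplex ℝ (Fin (n + 2))) → ℤ) (v : Fin k → stdSimplex ℝ (Fin (n + 1))) :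
    subdivIter bary N (fun u => F (faceMap j ∘ u)) v = subdivIter bary N F (faceMap j ∘ v) :=
  subdivIter_comp bary bary (faceMap j) (map_bary _) N F v

/-- The functions recording whether a barycentric coordinate is at most `c`. -/
def lowCoord (c : ℝ) {n : ℕ} (i : Fin n) (x : stdSimplex ℝ (Fin (n + 1))) : ℤ :=
  if x.1 i.succ ≤ c then 1 else 0

/-- A nonzero product makes every indicator jump between two vertices of the tuple, so on a small
tuple every f i is close to the threshold. -/
theorem le_of_cupCochain_lowCoord_ne_zero {c ε : ℝ} {n : ℕ}
    {E : Type*} (f : Fin n → E → ℝ) (w : Fin (n + 1) → E)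
    (hε : ∀ i j j', |f i (w j) - f i (w j')| ≤ ε)
    (h : cupCochain (fun i x => if f i x ≤ c then 1 else 0) w ≠ 0) (i : Fin n)
    (j : Fin (n + 1)) : |f i (w j) - c| ≤ ε := by
  have hi : (if f i (w i.succ) ≤ c then (1 : ℤ) else 0) - (if f i (w i.castSucc) ≤ c then 1 else 0) ≠
      0 := fun h0 => h (Finset.prod_eq_zero (Finset.mem_univ i) h0)
  have h1 := abs_le.1 (hε i j i.succ)
  have h2 := abs_le.1 (hε i j i.castSucc)
  rw [abs_le]
  split_ifs at hi with ha hb hb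
  · simp at hi
  · constructor <;> linarith [h1.1, h1.2, h2.1, h2.2]
  · constructor <;> linarith [h1.1, h1.2, h2.1, h2.2]
  · simp at hi

theorem abs_coord_sub_le {ι : Type} [Fintype ι] {x y : stdSimplex ℝ ι} {ε : ℝ} (h : dist x y ≤ ε)
    (i : ι) : |x.1 i - y.1 i| ≤ ε :=
  (dist_le_pi_dist x.1 y.1 i).trans h

/-- Geometrically this is the signed count of the points where all coordinates but the zeroth equal
c; the condition n * c < 1 leaves exactly one. By induction: the product is the coboundary of h₀ ∪
δh₁ ∪ …, so it is evaluated on the faces. Face 0 contributes nothing, as its coordinates cannot all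
be near or below c and still sum to 1. On face 1 the factor h₀ is 1, and the case of one dimension
less remains with sign −1. On every later face some other indicator is constant. -/
theorem eventually_subdivIter_cupCochain (c : ℝ) (hc : 0 ≤ c) : ∀ n : ℕ, n * c < 1 →
    ∀ᶠ N in Filter.atTop,
      subdivIter bary N (cupCochain (lowCoord c (n := n))) (vertices n) = (-1) ^ n
  | 0, _ => Filter.Eventually.of_forall fun N => by
    have : cupCochain (lowCoord c (n := 0)) = coface (fun _ : Fin 0 → _ => 1) := by
      funext v
      simp [cupCochain, coface]
    rw [this, subdivIter_coface, subdivIter_of_zero]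
    simp [coface]
  | n + 1, hn => by
    push_cast at hn
    set G : (Fin (n + 1) → stdSimplex ℝ (Fin (n + 2))) → ℤ := fun u =>
      lowCoord c 0 (u 0) * cupCochain (Fin.tail (lowCoord c)) u with hG
    have h0 : ∀ᶠ N in Filter.atTop,
        subdivIter bary N (fun u => G (faceMap 0 ∘ u)) (vertices n) = 0 := by
      -- The first coordinate is at most c and the n others at most c + ε, so their sum is at most
      -- (n+1)c + nε; this ε keeps it below 1.
      have hε : 0 < (1 - (n + 1) * c) / (n + 1) := div_pos (by linarith) (by positivity)
      have := eventually_subdivIter_eq hε (fun u => G (faceMap 0 ∘ u)) (fun _ => 0) ?_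
      · filter_upwards [this] with N hN
        rw [hN, subdivIter_zero]
      intro w hw
      by_contra hne
      have hcoord : ∀ (x : stdSimplex ℝ (Fin (n + 1))) (i : Fin (n + 1)),
          (faceMap 0 x).1 i.succ = x.1 i := fun x i => faceMap_succAbove 0 x i
      have hne1 : lowCoord c 0 (faceMap 0 (w 0)) ≠ 0 := left_ne_zero_of_mul hne
      have hne2 : cupCochain (fun i x => if x.1 i.succ ≤ c then 1 else 0) w ≠ 0 := by
        have h2 := right_ne_zero_of_mul hne
        contrapose! h2
        rw [← h2]
        refine Finset.prod_congr rfl fun i _ => ?_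
        simp only [Fin.tail, lowCoord, Function.comp_apply, hcoord]
      have h1 : (w 0).1 0 ≤ c := by
        simp only [lowCoord, hcoord] at hne1
        by_contra hlt
        simp [hlt] at hne1
      have h2 := fun i => (abs_le.1 (le_of_cupCochain_lowCoord_ne_zero
        (fun (i : Fin n) (x : stdSimplex ℝ (Fin (n + 1))) => x.1 i.succ) w
        (fun i j j' => abs_coord_sub_le (hw j j') _) hne2 i 0)).2
      have hsum : ∑ i, (w 0).1 i = 1 := (w 0).2.2
      rw [Fin.sum_univ_succ] at hsum
      have h3 : ∑ i : Fin n, (w 0).1 i.succ ≤ ∑ i : Fin n, ((1 - (n + 1) * c) / (n + 1) + c) :=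
        Finset.sum_le_sum fun i _ => by linarith [h2 i]
      have h4 : (n + 1 : ℝ) * ((1 - (n + 1) * c) / (n + 1)) = 1 - (n + 1) * c := by field_simp
      simp at h3
      linarith
    filter_upwards [h0, eventually_subdivIter_cupCochain c hc n (by linarith)] with N hN hN'
    rw [cupCochain_eq_coface, subdivIter_coface, coface]
    simp only [smul_eq_mul, ← faceMap_comp_vertices, ← subdivIter_faceMap]
    rw [Fin.sum_univ_succ, hN, mul_zero, zero_add, Fin.sum_univ_succ, Finset.sum_eq_zero]
    · have : (fun u : Fin (n + 1) → stdSimplex ℝ (Fin (n + 1)) => G (faceMap 1 ∘ u)) =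
          cupCochain (lowCoord c) := by
        funext u
        have h1 : lowCoord c 0 (faceMap 1 (u 0)) = 1 := by
          have := faceMap_self 1 (u 0)
          have h01 : (Fin.succ 0 : Fin (n + 2)) = 1 := rfl
          simp [lowCoord, h01, this, hc]
        simp only [hG, Function.comp_apply, h1, one_mul]
        refine Finset.prod_congr rfl fun i _ => ?_
        have hcoord : ∀ x : stdSimplex ℝ (Fin (n + 1)), (faceMap 1 x).1 i.succ.succ = x.1 i.succ := by
          intro x
          rw [← faceMap_succAbove 1 x i.succ]
          congr 1
        simp only [Fin.tail, lowCoord, Function.comp_apply, hcoord]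
      simp only [Fin.succ_zero_eq_one, hG] at this ⊢
      rw [this, hN', Fin.val_one, add_zero, pow_succ]
      ring
    · intro i _
      have : (fun u : Fin (n + 1) → stdSimplex ℝ (Fin (n + 1)) => G (faceMap i.succ.succ ∘ u)) =
          fun _ => 0 := by
        funext u
        refine mul_eq_zero_of_right _ (cupCochain_eq_zero _ _ i ?_)
        simp only [Fin.tail, lowCoord, Function.comp_apply, faceMap_self]
      rw [this, subdivIter_zero, mul_zero]

/-! ### A cocycle on the collapsed cell -/

section Pinch

/-- Whether the `i`-th coordinate of a point of the open cell is non-negative. -/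
def signCoord {n : ℕ} (i : Fin n) (p : Pinch n) : ℤ :=
  p.elim 0 fun x => if 0 ≤ x.1 i then 1 else 0

/-- The points of the open cell of norm at most `1 / 2`. -/
def core (n : ℕ) : Set (Pinch n) :=
  (fun x : Metric.ball (0 : Fin n → ℝ) 1 => (x : Pinch n)) '' {x | ‖x.1‖ ≤ 1 / 2}

/-- A ball of radius `1 / 4` in the open cell. -/
def smallBall {n : ℕ} (x : Metric.ball (0 : Fin n → ℝ) 1) : Set (Pinch n) :=
  (fun x : Metric.ball (0 : Fin n → ℝ) 1 => (x : Pinch n)) '' Metric.ball x (1 / 4)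

theorem isClosed_core (n : ℕ) : IsClosed (core n) := by
  have hK : IsCompact {x : Metric.ball (0 : Fin n → ℝ) 1 | ‖x.1‖ ≤ 1 / 2} := by
    rw [Subtype.isCompact_iff]
    suffices this : Subtype.val '' {x : Metric.ball (0 : Fin n → ℝ) 1 | ‖x.1‖ ≤ 1 / 2} =
        Metric.closedBall (0 : Fin n → ℝ) (1 / 2) by
      rw [this]
      exact isCompact_closedBall _ _
    refine Set.ext fun y => ?_
    constructor
    · rintro ⟨x, hx, rfl⟩
      simpa using hx
    · intro hy
      have hy' : ‖y‖ ≤ 1 / 2 := by simpa using hy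
      exact ⟨⟨y, by simpa using (by linarith : ‖y‖ < 1)⟩, hy', rfl⟩
  exact OnePoint.isClosed_image_coe.2 ⟨hK.isClosed, hK⟩

theorem isOpen_smallBall {n : ℕ} (x : Metric.ball (0 : Fin n → ℝ) 1) : IsOpen (smallBall x) :=
  OnePoint.isOpen_image_coe.2 Metric.isOpen_ball

open Classical in
/-- The fundamental cochain of the collapsed cell. -/
def pinchCochain (n : ℕ) (v : Fin (n + 1) → Pinch n) : ℤ :=
  if ∃ i, v i ∈ core n then cupCochain signCoord v else 0

theorem pinchCochain_eq_zero {n : ℕ} (v : Fin (n + 1) → Pinch n) (h : ∀ i, v i ∉ core n) :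
    pinchCochain n v = 0 :=
  if_neg fun ⟨i, hi⟩ => h i hi

/-- The cut-off is invisible inside a small ball. If no vertex is in the core, some coordinate of
the first vertex exceeds 1/2 in absolute value; any two vertices are less than 1/4 + 1/4 apart, so
that coordinate has constant sign and the product vanishes anyway. -/
theorem pinchCochain_eq {n : ℕ} (v : Fin (n + 1) → Pinch n)
    (x : Metric.ball (0 : Fin n → ℝ) 1) (h : ∀ i, v i ∈ smallBall x) :
    pinchCochain n v = cupCochain signCoord v := by
  by_cases hv : ∃ i, v i ∈ core n
  · exact if_pos hv
  rw [pinchCochain, if_neg hv]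
  choose y hy hyv using h
  push Not at hv
  have h0 : 1 / 2 < ‖(y 0).1‖ := by
    by_contra hle
    exact hv 0 ⟨y 0, not_lt.1 hle, hyv 0⟩
  obtain ⟨j, hj⟩ : ∃ j, 1 / 2 < |(y 0).1 j| := by
    by_contra! hle
    exact h0.not_ge ((pi_norm_le_iff_of_nonneg (by norm_num)).2 hle)
  refine (cupCochain_eq_zero _ _ j ?_).symm
  have hd : ∀ i, |(y i).1 j - (y 0).1 j| < 1 / 2 := by
    intro i
    refine (dist_le_pi_dist (y i).1 (y 0).1 j).trans_lt ?_
    change dist (y i) (y 0) < _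
    have := dist_triangle_right (y i) (y 0) x
    have h1 := Metric.mem_ball.1 (hy i)
    have h2 := Metric.mem_ball.1 (hy 0)
    linarith
  rw [← hyv, ← hyv]
  change (if 0 ≤ (y j.succ).1 j then (1 : ℤ) else 0) = if 0 ≤ (y j.castSucc).1 j then 1 else 0
  have h1 := abs_lt.1 (hd j.succ)
  have h2 := abs_lt.1 (hd j.castSucc)
  rcases lt_abs.1 hj with hj | hj
  · rw [if_pos (by linarith [h1.1]), if_pos (by linarith [h2.1])]
  · rw [if_neg (by linarith [h1.2]), if_neg (by linarith [h2.2])]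

/-- Fine simplices either avoid the core, where the cochain is zero, or lie in a small ball, where
it is a genuine cup product. In both cases it is closed. -/
theorem exists_lebesgue {n k : ℕ} (σ : C(stdSimplex ℝ (Fin (k + 1)), Pinch n)) :
    ∃ ε > 0, ∀ {m : ℕ} (u : Fin (m + 1) → stdSimplex ℝ (Fin (k + 1))),
      (∀ i j, dist (u i) (u j) ≤ ε) →
      (∀ i, σ (u i) ∉ core n) ∨ ∃ x, ∀ i, σ (u i) ∈ smallBall x := by
  have hcov : (Set.univ : Set (stdSimplex ℝ (Fin (k + 1)))) ⊆
      ⋃ o : Option (Metric.ball (0 : Fin n → ℝ) 1),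
        σ ⁻¹' (o.elim (core n)ᶜ smallBall) := by
    intro t _
    rw [Set.mem_iUnion]
    by_cases ht : σ t ∈ core n
    · obtain ⟨x, -, hx⟩ := ht
      exact ⟨some x, x, by simp, hx⟩
    · exact ⟨none, ht⟩
  obtain ⟨δ, hδ, h⟩ := lebesgue_number_lemma_of_metric isCompact_univ (fun o => by
    refine IsOpen.preimage σ.continuous ?_
    cases o
    · exact (isClosed_core n).isOpen_compl
    · exact isOpen_smallBall _) hcov
  refine ⟨δ / 2, half_pos hδ, fun u hu => ?_⟩
  obtain ⟨o, ho⟩ := h (u 0) trivial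
  have hmem : ∀ i, σ (u i) ∈ o.elim (core n)ᶜ smallBall := fun i =>
    ho (Metric.mem_ball.2 ((hu i 0).trans_lt (half_lt_self hδ)))
  cases o with
  | none => exact Or.inl hmem
  | some x => exact Or.inr ⟨x, hmem⟩

/-- The value of the fundamental cocycle on a singular simplex: the eventual value of the
fundamental cochain on fine subdivisions. -/
def pinchValue {n : ℕ} (σ : C(stdSimplex ℝ (Fin (n + 1)), Pinch n)) :
    Filter.Germ (Filter.atTop : Filter ℕ) ℤ :=
  .ofFun fun N => subdivIter bary N (fun u => pinchCochain n (σ ∘ u)) (vertices n)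

theorem pinchValue_eq {n : ℕ} (σ : C(stdSimplex ℝ (Fin (n + 1)), Pinch n)) {ε : ℝ} (hε : 0 < ε)
    (F : (Fin (n + 1) → stdSimplex ℝ (Fin (n + 1))) → ℤ)
    (h : ∀ u, (∀ i j, dist (u i) (u j) ≤ ε) → pinchCochain n (σ ∘ u) = F u) :
    pinchValue σ = .ofFun fun N => subdivIter bary N F (vertices n) := by
  refine Filter.Germ.coe_eq.2 ?_
  filter_upwards [eventually_subdivIter_eq hε (fun u => pinchCochain n (σ ∘ u)) F h] with N hN
  exact hN _

theorem pinchValue_eq_zero {n : ℕ} (σ : C(stdSimplex ℝ (Fin (n + 1)), Pinch n)) {ε : ℝ}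
    (hε : 0 < ε) (h : ∀ u, (∀ i j, dist (u i) (u j) ≤ ε) → pinchCochain n (σ ∘ u) = 0) :
    pinchValue σ = 0 := by
  rw [pinchValue_eq σ hε (fun _ => 0) h]
  simp only [subdivIter_zero]
  rfl

/-- The inclusion of a face as a continuous map. -/
def faceC {n : ℕ} (j : Fin (n + 2)) :
    C(stdSimplex ℝ (Fin (n + 1)), stdSimplex ℝ (Fin (n + 2))) :=
  ⟨faceMap j, continuous_faceMap j⟩

/-- The cocycle condition. It holds for all sufficiently large N at once on the faces of σ, which is
equality of germs; thus no stabilization of the sequence in N is needed. -/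
theorem sum_pinchValue {n : ℕ} (σ : C(stdSimplex ℝ (Fin (n + 2)), Pinch n)) :
    ∑ i : Fin (n + 2), (-1 : ℤ) ^ (i : ℕ) • pinchValue (σ.comp (faceC i)) = 0 := by
  obtain ⟨ε, hε, h⟩ := exists_lebesgue σ
  have h0 : ∀ u : Fin (n + 2) → stdSimplex ℝ (Fin (n + 2)), (∀ i j, dist (u i) (u j) ≤ ε) →
      coface (fun u => pinchCochain n (σ ∘ u)) u = 0 := by
    intro u hu
    rcases h u hu with h1 | ⟨x, hx⟩
    · refine Finset.sum_eq_zero fun i _ => ?_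
      have := pinchCochain_eq_zero ((σ ∘ u) ∘ i.succAbove) fun j => h1 _
      exact (congrArg _ this).trans (smul_zero _)
    · rw [← coface_cupCochain signCoord (σ ∘ u)]
      refine Finset.sum_congr rfl fun i _ => ?_
      exact congrArg _ (pinchCochain_eq ((σ ∘ u) ∘ i.succAbove) x fun j => hx _)
  have key : ∀ᶠ N in Filter.atTop, ∑ i : Fin (n + 2), (-1 : ℤ) ^ (i : ℕ) •
      subdivIter bary N (fun u => pinchCochain n (σ.comp (faceC i) ∘ u)) (vertices n) = 0 := by
    filter_upwards [eventually_subdivIter_eq hε _ (fun _ => 0) h0] with N hN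
    have := hN (vertices (n + 1))
    rw [subdivIter_zero, subdivIter_coface, coface] at this
    refine Eq.trans ?_ this
    refine Finset.sum_congr rfl fun i _ => ?_
    rw [← faceMap_comp_vertices, ← subdivIter_faceMap]
    rfl
  have hsum : ∀ (s : Finset (Fin (n + 2))) (f : Fin (n + 2) → ℕ → ℤ),
      ∑ i ∈ s, (-1 : ℤ) ^ (i : ℕ) • (.ofFun (f i) : Filter.Germ Filter.atTop ℤ) =
        .ofFun fun N => ∑ i ∈ s, (-1 : ℤ) ^ (i : ℕ) • f i N := by
    classical
    intro s f
    induction s using Finset.induction_on with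
    | empty => rfl
    | insert a s ha ih =>
      rw [Finset.sum_insert ha, ih]
      simp only [Finset.sum_insert ha]
      rfl
  simp only [pinchValue]
  rw [hsum]
  exact Filter.Germ.coe_eq.2 key

theorem pinchValue_const {n : ℕ} (hn : n ≠ 0) (p : Pinch n) :
    pinchValue (.const _ p : C(stdSimplex ℝ (Fin (n + 1)), Pinch n)) = 0 := by
  refine pinchValue_eq_zero _ one_pos fun u _ => ?_
  rw [pinchCochain]
  split_ifs
  · exact cupCochain_eq_zero _ _ ⟨0, Nat.pos_of_ne_zero hn⟩ rfl
  · rfl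

end Pinch

/-! ### A parametrization of the sphere by the boundary of a simplex -/

section Param

/-- The affine map of the simplex onto a simplex around the origin. -/
def simplexVec {n : ℕ} (t : stdSimplex ℝ (Fin (n + 2))) (i : Fin (n + 1)) : ℝ :=
  1 / (n + 2) - t.1 i.succ

theorem continuous_simplexVec (n : ℕ) : Continuous (simplexVec (n := n)) :=
  continuous_pi fun i => continuous_const.sub ((continuous_apply i.succ).comp continuous_subtype_val)

/-- Only the barycenter is sent to the origin, and it lies on no face. This permits radial
projection of the boundary of the simplex to the sphere. -/
theorem simplexVec_ne_zero {n : ℕ} {t : stdSimplex ℝ (Fin (n + 2))} {j : Fin (n + 2)}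
    (hj : t.1 j = 0) : simplexVec t ≠ 0 := by
  intro h0
  have hn : (0 : ℝ) < (n : ℝ) + 2 := by positivity
  have h : ∀ i : Fin (n + 1), t.1 i.succ = 1 / (n + 2) := fun i =>
    (sub_eq_zero.1 (congrFun h0 i)).symm
  have hsum : ∑ i, t.1 i = 1 := t.2.2
  rw [Fin.sum_univ_succ, Finset.sum_congr rfl fun i _ => h i] at hsum
  have h00 : t.1 0 = 1 / (n + 2) := by
    simp at hsum
    field_simp at hsum ⊢
    linarith
  have : t.1 j = 1 / (n + 2) := by
    refine Fin.cases h00 (fun i => h i) j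
  rw [hj] at this
  exact (one_div_pos.2 hn).ne this

/-- The map of the affine simplex with vertices given by `u` to the sphere, if `u` misses the
vertex `j`. -/
def sphereSimplex {n m : ℕ} (u : Fin (m + 1) → Fin (n + 2)) (j : Fin (n + 2)) (hj : ∀ i, u i ≠ j) :
    C(stdSimplex ℝ (Fin (m + 1)), Sph n) :=
  have h0 : ∀ t, simplexVec (stdSimplex.map (S := ℝ) u t) ≠ 0 := fun t =>
    simplexVec_ne_zero (j := j) <| by
      rw [map_apply]
      refine Finset.sum_eq_zero fun i hi => ?_
      simp [hj] at hi
  ⟨fun t => ⟨‖simplexVec (stdSimplex.map (S := ℝ) u t)‖⁻¹ • simplexVec (stdSimplex.map u t), by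
      rw [mem_sphere_zero_iff_norm, norm_smul, norm_inv, norm_norm,
        inv_mul_cancel₀ (norm_ne_zero_iff.2 (h0 t))]⟩, by
    have hc := (continuous_simplexVec n).comp (stdSimplex.continuous_map (S := ℝ) u)
    exact (Continuous.smul (hc.norm.inv₀ fun t => norm_ne_zero_iff.2 (h0 t)) hc).subtype_mk _⟩

theorem sphereSimplex_apply {n m : ℕ} (u : Fin (m + 1) → Fin (n + 2)) (j : Fin (n + 2))
    (hj : ∀ i, u i ≠ j) (t : stdSimplex ℝ (Fin (m + 1))) :
    (sphereSimplex u j hj t).1 =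
      ‖simplexVec (stdSimplex.map (S := ℝ) u t)‖⁻¹ • simplexVec (stdSimplex.map u t) := rfl

theorem sphereSimplex_comp {n m : ℕ} (u : Fin (m + 2) → Fin (n + 2)) (j : Fin (n + 2))
    (hj : ∀ i, u i ≠ j) (i : Fin (m + 2)) (j' : Fin (n + 2)) (hj' : ∀ k, (u ∘ i.succAbove) k ≠ j') :
    (sphereSimplex u j hj).comp (faceC i) = sphereSimplex (u ∘ i.succAbove) j' hj' := by
  refine ContinuousMap.ext fun t => Subtype.ext ?_
  rw [ContinuousMap.comp_apply, sphereSimplex_apply, sphereSimplex_apply]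
  have : stdSimplex.map u (faceC i t) = stdSimplex.map (u ∘ i.succAbove) t :=
    stdSimplex.map_comp_apply _ _ _
  rw [this]

/-- The `j`-th face of the boundary of the simplex as a singular simplex of the sphere. -/
def sphereFace {n : ℕ} (j : Fin (n + 2)) : C(stdSimplex ℝ (Fin (n + 1)), Sph n) :=
  sphereSimplex j.succAbove j (Fin.succAbove_ne j)

/-- The reference map as a bundled map. -/
abbrev refC (n : ℕ) : C(Sph n, Pinch n) := ⟨refMap n, continuous_refMap n⟩

theorem sphereFace_apply {n : ℕ} (j : Fin (n + 2)) (t : stdSimplex ℝ (Fin (n + 1)))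
    (i : Fin (n + 1)) : (sphereFace j t).1 i =
      ‖simplexVec (faceMap j t)‖⁻¹ * simplexVec (faceMap j t) i := rfl

theorem norm_simplexVec_faceMap_pos {n : ℕ} (j : Fin (n + 2)) (t : stdSimplex ℝ (Fin (n + 1))) :
    0 < ‖simplexVec (faceMap j t)‖ :=
  norm_pos_iff.2 (simplexVec_ne_zero (faceMap_self j t))

/-- Radial projection preserves signs, and a coordinate of `simplexVec` is nonnegative exactly when
a barycentric coordinate is at most 1/(n+2). This translates sign functions on the cell into
threshold functions on the simplex; the index shifts twice, once in `simplexVec` and once in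
dropping the zeroth coordinate of the cube. -/
theorem refMap_eq_coe {n : ℕ} {j : Fin (n + 2)} {t : stdSimplex ℝ (Fin (n + 1))}
    {x : Metric.ball (0 : Fin n → ℝ) 1} (h : refMap n (sphereFace j t) = (x : Pinch n)) :
    0 < simplexVec (faceMap j t) 0 ∧ ∀ i : Fin n, signCoord i (x : Pinch n) =
      if (faceMap j t).1 i.succ.succ ≤ 1 / (n + 2) then 1 else 0 := by
  have hpos := inv_pos.2 (norm_simplexVec_faceMap_pos j t)
  rw [refMap] at h
  split_ifs at h with hx
  · have h' := (OnePoint.coe_injective h).symm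
    subst h'
    refine ⟨?_, fun i => ?_⟩
    · have := hx.1
      rw [sphereFace_apply] at this
      exact (pos_iff_pos_of_mul_pos this).1 hpos
    · change (if 0 ≤ (sphereFace j t).1 i.succ then (1 : ℤ) else 0) = _
      rw [sphereFace_apply]
      congr 1
      rw [mul_nonneg_iff_of_pos_left hpos, simplexVec, sub_nonneg]
  · exact absurd h (OnePoint.infty_ne_coe _)

theorem refMap_mem_core {n : ℕ} {j : Fin (n + 2)} {t : stdSimplex ℝ (Fin (n + 1))}
    (h0 : 0 < simplexVec (faceMap j t) 0)
    (h : ∀ i : Fin n, |simplexVec (faceMap j t) i.succ| ≤ simplexVec (faceMap j t) 0 / 2) :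
    refMap n (sphereFace j t) ∈ core n := by
  have hpos := inv_pos.2 (norm_simplexVec_faceMap_pos j t)
  have h1 : 0 < (sphereFace j t).1 0 := by
    rw [sphereFace_apply]
    positivity
  have h2 : ‖Fin.tail (sphereFace j t).1‖ ≤ 1 / 2 := by
    rw [pi_norm_le_iff_of_nonneg (by norm_num)]
    intro i
    have h3 : simplexVec (faceMap j t) 0 ≤ ‖simplexVec (faceMap j t)‖ :=
      (le_abs_self _).trans (norm_le_pi_norm (simplexVec (faceMap j t)) 0)
    have h4 := h i
    rw [Fin.tail, sphereFace_apply, Real.norm_eq_abs, abs_mul, abs_of_pos hpos,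
      inv_mul_le_iff₀ (norm_simplexVec_faceMap_pos j t)]
    linarith
  rw [refMap, dif_pos ⟨h1, by rw [mem_ball_zero_iff]; linarith⟩]
  exact ⟨_, h2, rfl⟩

theorem cupCochain_signCoord {n : ℕ} (j : Fin (n + 2))
    (u : Fin (n + 1) → stdSimplex ℝ (Fin (n + 1))) (x : Metric.ball (0 : Fin n → ℝ) 1)
    (hx : ∀ i, refMap n (sphereFace j (u i)) ∈ smallBall x) :
    (∀ i, 0 < simplexVec (faceMap j (u i)) 0) ∧
    cupCochain signCoord (((refC n).comp (sphereFace j)) ∘ u) =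
      cupCochain (fun i t => if (faceMap j t).1 i.succ.succ ≤ 1 / (n + 2) then 1 else 0) u := by
  choose y _ hy using hx
  refine ⟨fun i => (refMap_eq_coe (hy i).symm).1, Finset.prod_congr rfl fun i _ => ?_⟩
  have key : ∀ k, signCoord i (refMap n (sphereFace j (u k))) =
      if (faceMap j (u k)).1 i.succ.succ ≤ 1 / (n + 2) then 1 else 0 := fun k =>
    (congrArg (signCoord i) (hy k).symm).trans ((refMap_eq_coe (hy k).symm).2 i)
  exact congrArg₂ _ (key _) (key _)

theorem pinchValue_sphereFace_succ_succ {n : ℕ} (j : Fin n) :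
    pinchValue ((refC n).comp (sphereFace j.succ.succ)) = 0 := by
  obtain ⟨ε, hε, h⟩ := exists_lebesgue ((refC n).comp (sphereFace (n := n) j.succ.succ))
  refine pinchValue_eq_zero _ hε fun u hu => ?_
  rcases h u hu with h1 | ⟨x, hx⟩
  · exact pinchCochain_eq_zero _ h1
  · rw [pinchCochain_eq (_ ∘ u) x hx, (cupCochain_signCoord _ u x hx).2]
    refine cupCochain_eq_zero _ _ j ?_
    simp only [faceMap_self]

/-- On this face t₀ = 0. A nonzero value would need t₁ < 1/(n+2) and all later coordinates near
1/(n+2), but then the coordinates sum to less than 1. -/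
theorem pinchValue_sphereFace_zero (n : ℕ) :
    pinchValue ((refC n).comp (sphereFace 0)) = 0 := by
  obtain ⟨ε, hε, h⟩ := exists_lebesgue ((refC n).comp (sphereFace (n := n) 0))
  have hn : (0 : ℝ) < (n : ℝ) + 1 := by positivity
  have hn2 : (0 : ℝ) < (n : ℝ) + 2 := by positivity
  -- Chosen so that n(η + 1/(n+2)) + 1/(n+2) = (n² + 3n + 1)/(n² + 3n + 2), which is below 1.
  have hη : 0 < 1 / (((n : ℝ) + 2) * (n + 1)) := by positivity
  refine pinchValue_eq_zero _ (lt_min hε hη) fun u hu => ?_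
  rcases h u (fun i j => (hu i j).trans (min_le_left _ _)) with h1 | ⟨x, hx⟩
  · exact pinchCochain_eq_zero _ h1
  · rw [pinchCochain_eq (_ ∘ u) x hx, (cupCochain_signCoord _ u x hx).2]
    by_contra hne
    have h0 := (cupCochain_signCoord _ u x hx).1 0
    have hcoord : ∀ (x : stdSimplex ℝ (Fin (n + 1))) (i : Fin (n + 1)),
        (faceMap 0 x).1 i.succ = x.1 i := fun x i => faceMap_succAbove 0 x i
    rw [simplexVec, hcoord] at h0
    simp only [hcoord] at hne
    have h2 := fun i => (abs_le.1 (le_of_cupCochain_lowCoord_ne_zero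
        (fun (i : Fin n) (x : stdSimplex ℝ (Fin (n + 1))) => x.1 i.succ) u
        (fun i j j' => abs_coord_sub_le ((hu j j').trans (min_le_right _ _)) _) hne i 0)).2
    have hsum : ∑ i, (u 0).1 i = 1 := (u 0).2.2
    rw [Fin.sum_univ_succ] at hsum
    have h3 : ∑ i : Fin n, (u 0).1 i.succ ≤
        ∑ i : Fin n, (1 / (((n : ℝ) + 2) * (n + 1)) + 1 / (n + 2)) :=
      Finset.sum_le_sum fun i _ => by linarith [h2 i]
    have h4 : (n : ℝ) * (1 / (((n : ℝ) + 2) * (n + 1)) + 1 / (n + 2)) + 1 / (n + 2) ≤ 1 := by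
      rw [div_add_div _ _ (by positivity) (by positivity), ← mul_div_assoc,
        div_add_div _ _ (by positivity) (by positivity), div_le_one (by positivity)]
      have : (0 : ℝ) ≤ n := n.cast_nonneg
      nlinarith [mul_nonneg this this, mul_nonneg (mul_nonneg this this) this]
    simp only [Finset.sum_const, Finset.card_univ, Fintype.card_fin, nsmul_eq_mul] at h3
    linarith

/-- The only face that counts. Here t₁ = 0, so the zeroth cube coordinate before normalization is
the constant 1/(n+2), and the cochain becomes the product of threshold functions evaluated earlier.
-/
theorem pinchValue_sphereFace_one (n : ℕ) :
    pinchValue ((refC n).comp (sphereFace 1)) = .ofFun fun _ => (-1) ^ n := by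
  obtain ⟨ε, hε, h⟩ := exists_lebesgue ((refC n).comp (sphereFace (n := n) 1))
  have hn2 : (0 : ℝ) < (n : ℝ) + 2 := by positivity
  -- Half of the constant zeroth coordinate: a small tuple with nonzero product then lies in the
  -- core, so the cut-off loses nothing.
  have hη : 0 < 1 / ((n : ℝ) + 2) / 2 := by positivity
  have h0 : ∀ t : stdSimplex ℝ (Fin (n + 1)), simplexVec (faceMap 1 t) 0 = 1 / (n + 2) := by
    intro t
    have : (faceMap 1 t).1 (Fin.succ 0) = 0 := faceMap_self 1 t
    rw [simplexVec, this, sub_zero]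
  have hcoord : ∀ (t : stdSimplex ℝ (Fin (n + 1))) (i : Fin n),
      (faceMap 1 t).1 i.succ.succ = t.1 i.succ := by
    intro t i
    rw [← faceMap_succAbove 1 t i.succ]
    congr 1
  rw [pinchValue_eq _ (lt_min hε hη) (cupCochain (lowCoord (1 / ((n : ℝ) + 2))))]
  · refine Filter.Germ.coe_eq.2 (eventually_subdivIter_cupCochain _ (by positivity) n ?_)
    rw [mul_one_div, div_lt_one hn2]
    linarith
  intro u hu
  have hzero : (∀ i, refMap n (sphereFace 1 (u i)) ∉ core n) →
      cupCochain (lowCoord (1 / ((n : ℝ) + 2))) u = 0 := by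
    intro hcore
    by_contra hne
    refine hcore 0 (refMap_mem_core ?_ fun i => ?_)
    · rw [h0]
      positivity
    · rw [h0, simplexVec, hcoord, abs_sub_comm]
      exact le_of_cupCochain_lowCoord_ne_zero
        (fun (i : Fin n) (x : stdSimplex ℝ (Fin (n + 1))) => x.1 i.succ) u
        (fun i j j' => abs_coord_sub_le ((hu j j').trans (min_le_right _ _)) _) hne i 0
  rcases h u (fun i j => (hu i j).trans (min_le_left _ _)) with h1 | ⟨x, hx⟩
  · rw [pinchCochain_eq_zero (_ ∘ u) h1, hzero h1]
  · rw [pinchCochain_eq (_ ∘ u) x hx, (cupCochain_signCoord _ u x hx).2]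
    simp only [hcoord]
    rfl

theorem sum_pinchValue_sphereFace (n : ℕ) :
    ∑ j : Fin (n + 2), (-1 : ℤ) ^ (j : ℕ) • pinchValue ((refC n).comp (sphereFace j)) =
      .ofFun fun _ => (-1) ^ (n + 1) := by
  rw [Fin.sum_univ_succ, Fin.sum_univ_succ, Finset.sum_eq_zero, pinchValue_sphereFace_zero,
    Fin.succ_zero_eq_one, pinchValue_sphereFace_one]
  · rw [smul_zero, zero_add, add_zero, Fin.val_one, pow_one, pow_succ, mul_neg_one]
    simp only [neg_smul, one_smul]
    rfl
  · intro j _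
    rw [pinchValue_sphereFace_succ_succ, smul_zero]

end Param

/-! ### Evaluation on singular homology -/

section Singular

open Opposite Simplicial

/-- A continuous map from the standard simplex as a simplex of the singular simplicial set. -/
def sing {W : Type} [TopologicalSpace W] {n : ℕ} (σ : C(stdSimplex ℝ (Fin (n + 1)), W)) :
    (TopCat.toSSet.obj (TopCat.of W)) _⦋n⦌ :=
  ((TopCat.of W).toSSetObjEquiv (op ⦋n⦌)).symm σ

theorem sing_surjective {W : Type} [TopologicalSpace W] {n : ℕ}
    (x : (TopCat.toSSet.obj (TopCat.of W)) _⦋n⦌) :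
    ∃ σ : C(stdSimplex ℝ (Fin (n + 1)), W), sing σ = x :=
  ((TopCat.of W).toSSetObjEquiv (op ⦋n⦌)).symm.surjective x

/-- The integral singular chain complex. -/
abbrev singChains (W : Type) [TopologicalSpace W] : ChainComplex (ModuleCat.{0} ℤ) ℕ :=
  (TopCat.toSSet.obj (TopCat.of W)).chainComplex (ModuleCat.of ℤ ℤ)

/-- The morphism `ℤ ⟶ C_n(W)` picking out a singular simplex. -/
def ιSing {W : Type} [TopologicalSpace W] {n : ℕ} (σ : C(stdSimplex ℝ (Fin (n + 1)), W)) :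
    ModuleCat.of ℤ ℤ ⟶ (singChains W).X n :=
  (TopCat.toSSet.obj (TopCat.of W)).ιChainComplex (sing σ)

/-- The map of singular chain complexes induced by a continuous map. -/
abbrev singChainsMap {W W' : Type} [TopologicalSpace W] [TopologicalSpace W'] (g : C(W, W')) :
    singChains W ⟶ singChains W' :=
  SSet.chainComplexMap (TopCat.toSSet.map (TopCat.ofHom g)) (ModuleCat.of ℤ ℤ)

theorem ιSing_d {W : Type} [TopologicalSpace W] {n : ℕ} (σ : C(stdSimplex ℝ (Fin (n + 2)), W)) :
    ιSing σ ≫ (singChains W).d (n + 1) n =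
      ∑ i : Fin (n + 2), (-1 : ℤ) ^ (i : ℕ) • ιSing (σ.comp (faceC i)) :=
  SSet.ιChainComplex_d _ _ _

theorem ιSing_map {W W' : Type} [TopologicalSpace W] [TopologicalSpace W'] {n : ℕ}
    (g : C(W, W')) (σ : C(stdSimplex ℝ (Fin (n + 1)), W)) :
    ιSing σ ≫ (singChainsMap g).f n = ιSing (g.comp σ) :=
  SSet.ι_chainComplexMap_f _ _ _ _ _

theorem singChains_hom_ext {W : Type} [TopologicalSpace W] {n : ℕ} {A : ModuleCat.{0} ℤ}
    {f g : (singChains W).X n ⟶ A} (h : ∀ σ, ιSing σ ≫ f = ιSing σ ≫ g) : f = g :=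
  SSet.chainComplex_hom_ext fun x => by
    obtain ⟨σ, rfl⟩ := sing_surjective x
    exact h σ

theorem exists_singChains_desc {W : Type} [TopologicalSpace W] {n : ℕ} {A : ModuleCat.{0} ℤ}
    (φ : C(stdSimplex ℝ (Fin (n + 1)), W) → (ModuleCat.of ℤ ℤ ⟶ A)) :
    ∃ f : (singChains W).X n ⟶ A, ∀ σ, ιSing σ ≫ f = φ σ :=
  ⟨Limits.Cofan.IsColimit.desc
      ((TopCat.toSSet.obj (TopCat.of W)).isColimitChainComplexXCofan (ModuleCat.of ℤ ℤ) n)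
      fun x => φ ((TopCat.of W).toSSetObjEquiv (op ⦋n⦌) x), fun _ =>
    (Limits.Cofan.IsColimit.fac _ _ _).trans (congrArg φ (Equiv.apply_symm_apply _ _))⟩

/-- The fundamental cycle of the sphere. -/
def sphereCycle (n : ℕ) : ModuleCat.of ℤ ℤ ⟶ (singChains (Sph n)).X n :=
  ∑ j : Fin (n + 2), (-1 : ℤ) ^ (j : ℕ) • ιSing (sphereFace j)

theorem exists_notMem_range {n m : ℕ} (h : m < n) (u : Fin m → Fin n) : ∃ j, ∀ i, u i ≠ j := by
  by_contra! hu
  have := Fintype.card_le_of_surjective u fun j => hu j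
  simp at this
  omega

theorem sphereCycle_d (n : ℕ) : sphereCycle (n + 1) ≫ (singChains (Sph (n + 1))).d (n + 1) n = 0 := by
  let F : (Fin (n + 1) → Fin (n + 3)) → (ModuleCat.of ℤ ℤ ⟶ (singChains (Sph (n + 1))).X n) :=
    -- Any omitted vertex may be chosen: it serves only to show that the projection is defined, and
    -- the simplex does not depend on it. The sphere cycle is then formally the coboundary of F at
    -- the identity, and its boundary is a double coboundary.
    fun u => ιSing (sphereSimplex u _ (exists_notMem_range (by omega) u).choose_spec)
  rw [← coface_coface F id, sphereCycle, Preadditive.sum_comp, coface]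
  refine Finset.sum_congr rfl fun j _ => ?_
  rw [Preadditive.zsmul_comp, ιSing_d, coface]
  refine congrArg _ (Finset.sum_congr rfl fun i _ => congrArg _ (congrArg ιSing ?_))
  exact sphereSimplex_comp _ _ _ _ _ _

/-- The morphism from `ℤ` to the group of germs of integer sequences given by a germ. -/
def germHom (x : Filter.Germ (Filter.atTop : Filter ℕ) ℤ) :
    ModuleCat.of ℤ ℤ ⟶ ModuleCat.of ℤ (Filter.Germ (Filter.atTop : Filter ℕ) ℤ) :=
  ModuleCat.ofHom (LinearMap.toSpanSingleton ℤ _ x)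

theorem germHom_injective : Function.Injective germHom := fun x y h => by
  have := congrArg (fun f => f.hom (1 : ℤ)) h
  simpa [germHom] using this

theorem germHom_add (x y) : germHom (x + y) = germHom x + germHom y := by
  refine ModuleCat.hom_ext (LinearMap.ext_ring ?_)
  simp [germHom]

/-- `germHom` as a homomorphism of groups. -/
def germHomAdd : Filter.Germ (Filter.atTop : Filter ℕ) ℤ →+
    (ModuleCat.of ℤ ℤ ⟶ ModuleCat.of ℤ (Filter.Germ (Filter.atTop : Filter ℕ) ℤ)) :=
  AddMonoidHom.mk' germHom germHom_add

/-- A class in `H_{n+1}` of the sphere and a functional on `H_{n+1}` of the collapsed cell which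
together detect the degree. -/
theorem exists_degree_detector (n : ℕ) :
    ∃ (z : ModuleCat.of ℤ ℤ ⟶ (singChains (Sph (n + 1))).homology (n + 1))
      (φ : (singChains (Pinch (n + 1))).homology (n + 1) ⟶
        ModuleCat.of ℤ (Filter.Germ (Filter.atTop : Filter ℕ) ℤ)),
      ∀ g : C(Sph (n + 1), Pinch (n + 1)), z ≫ HomologicalComplex.homologyMap (singChainsMap g) (n + 1) ≫ φ =
        germHomAdd (∑ j : Fin (n + 3), (-1 : ℤ) ^ (j : ℕ) • pinchValue (g.comp (sphereFace j))) := by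
  obtain ⟨f, hf⟩ := exists_singChains_desc (W := Pinch (n + 1)) (n := n + 1)
    fun σ => germHomAdd (pinchValue σ)
  have hd : (singChains (Pinch (n + 1))).d (n + 2) (n + 1) ≫ f = 0 := by
    refine singChains_hom_ext fun σ => ?_
    rw [← Category.assoc, ιSing_d, Preadditive.sum_comp, Limits.comp_zero]
    simp only [Preadditive.zsmul_comp, hf, ← map_zsmul, ← map_sum]
    rw [sum_pinchValue σ, map_zero]
  refine ⟨HomologicalComplex.liftCycles _ (sphereCycle (n + 1)) n (by simp) (sphereCycle_d n) ≫
    HomologicalComplex.homologyπ _ _, HomologicalComplex.homologyι _ _ ≫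
      HomologicalComplex.descOpcycles _ f (n + 2) (by simp) hd, fun g => ?_⟩
  simp only [Category.assoc, HomologicalComplex.homologyπ_naturality_assoc,
    HomologicalComplex.homology_π_ι_assoc, HomologicalComplex.p_descOpcycles,
    HomologicalComplex.cyclesMap_i_assoc, HomologicalComplex.liftCycles_i_assoc]
  rw [← Category.assoc, sphereCycle, Preadditive.sum_comp, Preadditive.sum_comp, map_sum]
  refine Finset.sum_congr rfl fun j _ => ?_
  rw [Preadditive.zsmul_comp, Preadditive.zsmul_comp, ιSing_map, hf, map_zsmul]

/-- Pairing with the detector gives 0 for a constant map and d · (±1) for d times the reference map.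
This forces whichever d was chosen to be 0. -/
theorem degree_const (n : ℕ) (g : C(Sph (n + 1), Pinch (n + 1))) (p : Pinch (n + 1))
    (hg : ∀ x, g x = p) : degree g = 0 := by
  rw [degree]
  split_ifs with h
  · obtain ⟨z, φ, hz⟩ := exists_degree_detector n
    have hs : HomologicalComplex.homologyMap (singChainsMap g) (n + 1) =
        h.choose • HomologicalComplex.homologyMap (singChainsMap (refC (n + 1))) (n + 1) :=
      h.choose_spec
    generalize h.choose = d at hs ⊢
    have h1 := hz g
    rw [hs, Preadditive.zsmul_comp, Preadditive.comp_zsmul, hz, sum_pinchValue_sphereFace] at h1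
    have h2 : ∀ j : Fin (n + 3), g.comp (sphereFace j) = .const _ p := fun j =>
      ContinuousMap.ext fun x => hg _
    simp only [h2, pinchValue_const (Nat.succ_ne_zero n), smul_zero, Finset.sum_const_zero] at h1
    rw [← map_zsmul] at h1
    have h3 := germHom_injective h1
    have h4 : (Filter.Germ.ofFun (fun _ => d * (-1) ^ (n + 1 + 1)) :
        Filter.Germ (Filter.atTop : Filter ℕ) ℤ) = .ofFun fun _ => 0 := h3
    obtain ⟨N, hN⟩ := (Filter.Germ.coe_eq.1 h4).exists
    simpa using hN
  · rfl

end Singular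

/-! ### Cells of subcomplexes -/

section Cells

universe u

variable {X : Type u} [TopologicalSpace X] [T2Space X] {C : Set X} [CWComplex C]

theorem mem_I_of_inter {E : Subcomplex C} {n : ℕ} {e : cell C n} {x : X}
    (hx : x ∈ openCell n e) (hxE : x ∈ E) : e ∈ E.I n := by
  by_contra h
  exact Set.disjoint_left.1
    (RelCWComplex.Subcomplex.disjoint_openCell_subcomplex_of_not_mem E h) hx hxE

theorem openCell_nonempty {n : ℕ} (e : cell C n) : (openCell n e).Nonempty :=
  ⟨map n e 0, 0, Metric.mem_ball_self one_pos, rfl⟩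

theorem I_mono {E F : Subcomplex C} (h : E ≤ F) (n : ℕ) : E.I n ⊆ F.I n := by
  intro e he
  obtain ⟨x, hx⟩ := openCell_nonempty e
  exact mem_I_of_inter hx (h (RelCWComplex.Subcomplex.openCell_subset_of_mem E he hx))

theorem I_eq_empty {E : Subcomplex C} (h : (E : Set X) = ∅) (n : ℕ) : E.I n = ∅ := by
  refine Set.eq_empty_of_forall_notMem fun e he => ?_
  obtain ⟨x, hx⟩ := openCell_nonempty e
  have := RelCWComplex.Subcomplex.openCell_subset_of_mem E he hx
  rw [h] at this
  exact this

theorem skeleton_I_eq_univ {k n : ℕ} (h : n ≤ k) : (skeleton C (k : ℕ∞)).I n = Set.univ := by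
  refine Set.eq_univ_of_forall fun e => ?_
  obtain ⟨x, hx⟩ := openCell_nonempty e
  refine mem_I_of_inter hx ?_
  exact RelCWComplex.skeleton_mono (by exact_mod_cast h)
    (RelCWComplex.closedCell_subset_skeleton n e (RelCWComplex.openCell_subset_closedCell n e hx))

theorem skeleton_I_eq_empty {k n : ℕ} (h : k < n) : (skeleton C (k : ℕ∞)).I n = ∅ := by
  refine Set.eq_empty_of_forall_notMem fun e he => ?_
  obtain ⟨x, hx⟩ := openCell_nonempty e
  have h1 := RelCWComplex.Subcomplex.openCell_subset_of_mem _ he hx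
  refine Set.disjoint_left.1 (RelCWComplex.disjoint_skeleton_openCell (C := C) ?_) h1 hx
  exact_mod_cast h

variable [CWComplex.Finite C]

/-- The closed cell e lies in E, while the open cell e' misses E; hence the collapsed attaching map
is constant at infinity. -/
theorem incidence_eq_zero (E : Subcomplex C) : ∀ {n : ℕ} (e : cell C (n + 1)) (e' : cell C n)
    (_ : e ∈ E.I (n + 1)) (_ : e' ∉ E.I n), incidence e e' = 0
  | 0, e, e', he, he' => by
    have h : ∀ x ∈ Metric.closedBall (0 : Fin 1 → ℝ) 1, map 1 e x ∉ openCell 0 e' := by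
      intro x hx hx'
      exact he' (mem_I_of_inter hx'
        (RelCWComplex.Subcomplex.closedCell_subset_of_mem E he ⟨x, hx, rfl⟩))
    have h1 : (fun _ => 1 : Fin 1 → ℝ) ∈ Metric.closedBall (0 : Fin 1 → ℝ) 1 := by
      rw [mem_closedBall_zero_iff, pi_norm_le_iff_of_nonneg zero_le_one]
      simp
    have h2 : (fun _ => -1 : Fin 1 → ℝ) ∈ Metric.closedBall (0 : Fin 1 → ℝ) 1 := by
      rw [mem_closedBall_zero_iff, pi_norm_le_iff_of_nonneg zero_le_one]
      simp
    rw [incidence, if_neg (h _ h1), if_neg (h _ h2), sub_zero]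
  | n + 1, e, e', he, he' => by
    refine degree_const n _ OnePoint.infty fun x => ?_
    refine dif_neg fun hx => he' (mem_I_of_inter hx ?_)
    exact RelCWComplex.Subcomplex.closedCell_subset_of_mem E he
      ⟨x.1, Metric.sphere_subset_closedBall x.2, rfl⟩

theorem boundaryMatrix_eq_zero (E : Subcomplex C) {n : ℕ} (e : cell C (n + 1)) (e' : cell C n)
    (he : e ∈ E.I (n + 1)) (he' : e' ∉ E.I n) : boundaryMatrix C n e' e = 0 := by
  unfold boundaryMatrix
  split_ifs
  · exact incidence_eq_zero E e e' he he'
  · rfl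

variable (R : Type) [CommRing R]

theorem boundary_apply (k : ℕ) (c : Chains C R (k + 1)) (e' : cell C k) :
    boundary C R k c e' = ∑ e, (boundaryMatrix C k e' e : R) * c e := rfl

theorem boundary_boundary (k : ℕ) (c : Chains C R (k + 2)) :
    boundary C R k (boundary C R (k + 1) c) = 0 := by
  have h : (boundaryMatrix C k).map (Int.cast : ℤ → R) *
      (boundaryMatrix C (k + 1)).map (Int.cast : ℤ → R) = 0 := by
    have := Matrix.map_mul (L := boundaryMatrix C k) (M := boundaryMatrix C (k + 1))
      (f := Int.castRingHom R)
    rw [boundaryMatrix_mul] at this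
    simpa using this.symm
  simp only [boundary, Matrix.mulVecLin_apply, Matrix.mulVec_mulVec, h, Matrix.zero_mulVec]

theorem boundary_mem_chains (E : Subcomplex C) (k : ℕ) {c : Chains C R (k + 1)}
    (hc : c ∈ chains R E (k + 1)) : boundary C R k c ∈ chains R E k := by
  intro e' he'
  rw [boundary_apply]
  refine Finset.sum_eq_zero fun e _ => ?_
  by_cases he : e ∈ E.I (k + 1)
  · rw [boundaryMatrix_eq_zero E e e' he he', Int.cast_zero, zero_mul]
  · rw [hc e he, mul_zero]

theorem boundaries_le_chains (E : Subcomplex C) (k : ℕ) : boundaries R E k ≤ chains R E k := by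
  rintro _ ⟨c, hc, rfl⟩
  exact boundary_mem_chains R E k hc

theorem boundaries_le_cycles (E : Subcomplex C) : ∀ k, boundaries R E k ≤ cycles R E k
  | 0 => boundaries_le_chains R E 0
  | k + 1 => le_inf (boundaries_le_chains R E (k + 1)) <| by
      rintro _ ⟨c, -, rfl⟩
      exact boundary_boundary R k c

theorem cycles_le_chains (E : Subcomplex C) : ∀ k, cycles R E k ≤ chains R E k
  | 0 => le_rfl
  | _ + 1 => inf_le_left

theorem chains_mono {E F : Subcomplex C} {k : ℕ} (h : E.I k ⊆ F.I k) :
    chains R E k ≤ chains R F k := fun _ hc e he => hc e fun he' => he (h he')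

theorem chains_eq_top {E : Subcomplex C} {k : ℕ} (h : E.I k = Set.univ) : chains R E k = ⊤ :=
  eq_top_iff.2 fun _ _ e he => absurd (h ▸ Set.mem_univ e) he

theorem chains_eq_bot {E : Subcomplex C} {k : ℕ} (h : E.I k = ∅) : chains R E k = ⊥ :=
  (Submodule.eq_bot_iff _).2 fun _ hc => funext fun e => hc e (h ▸ Set.notMem_empty e)

theorem boundaries_mono {E F : Subcomplex C} {k : ℕ} (h : E.I (k + 1) ⊆ F.I (k + 1)) :
    boundaries R E k ≤ boundaries R F k := Submodule.map_mono (chains_mono R h)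

theorem boundaries_eq_bot {E : Subcomplex C} {k : ℕ} (h : E.I (k + 1) = ∅) :
    boundaries R E k = ⊥ := by
  rw [boundaries, chains_eq_bot R h, Submodule.map_bot]

theorem mem_cycles_of_le {E F : Subcomplex C} : ∀ {k : ℕ} {c : Chains C R k}
    (_ : c ∈ cycles R F k) (_ : c ∈ chains R E k), c ∈ cycles R E k
  | 0, _, _, h => h
  | _ + 1, _, h', h => ⟨h, h'.2⟩

theorem cycles_mono {E F : Subcomplex C} {k : ℕ} (h : E.I k ⊆ F.I k) :
    cycles R E k ≤ cycles R F k := fun _ hc =>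
  mem_cycles_of_le R (cycles_le_whole R E k hc) (chains_mono R h (cycles_le_chains R E k hc))

end Cells

/-! ### Squared determinants -/

section DetSq

variable {m m' n n' m₁ m₂ n₁ n₂ : Type*} [Fintype m] [Fintype m'] [Fintype n] [Fintype n']
  [Fintype m₁] [Fintype m₂] [Fintype n₁] [Fintype n₂] [DecidableEq n] [DecidableEq n']
  [DecidableEq n₁] [DecidableEq n₂]

theorem detSq_mul (e : n' ≃ n) (M : Matrix m n ℝ) (P : Matrix n n' ℝ) :
    detSq (M * P) = detSq M * detSq P := by
  have h : (M * P).transpose * (M * P) =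
      (P.submatrix e id).transpose * ((M.transpose * M).submatrix e e * P.submatrix e id) := by
    rw [Matrix.submatrix_mul_equiv, Matrix.transpose_submatrix, Matrix.submatrix_mul_equiv,
      Matrix.transpose_mul, Matrix.submatrix_id_id]
    simp only [Matrix.mul_assoc]
  rw [detSq, h, Matrix.det_mul, Matrix.det_mul, Matrix.det_submatrix_equiv_self,
    Matrix.det_transpose, detSq_eq P e, detSq]
  ring

theorem detSq_submatrix (e : m' ≃ m) (M : Matrix m n ℝ) :
    detSq (M.submatrix e id) = detSq M := by
  rw [detSq, Matrix.transpose_submatrix, Matrix.submatrix_mul_equiv, Matrix.submatrix_id_id, detSq]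

theorem detSq_fromBlocks_zero₂₁ (e₁ : n₁ ≃ m₁) (e₂ : n₂ ≃ m₂) (A : Matrix m₁ n₁ ℝ)
    (B : Matrix m₁ n₂ ℝ) (D : Matrix m₂ n₂ ℝ) :
    detSq (Matrix.fromBlocks A B 0 D) = detSq A * detSq D := by
  rw [detSq_eq _ (Equiv.sumCongr e₁ e₂), detSq_eq A e₁, detSq_eq D e₂, ← mul_pow,
    ← Matrix.det_fromBlocks_zero₂₁ _ (B.submatrix e₁ id)]
  congr 2
  ext (i | i) (j | j) <;> rfl

theorem detSq_fromBlocks_zero₁₂ (e₁ : n₁ ≃ m₁) (e₂ : n₂ ≃ m₂) (A : Matrix m₁ n₁ ℝ)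
    (B : Matrix m₂ n₁ ℝ) (D : Matrix m₂ n₂ ℝ) :
    detSq (Matrix.fromBlocks A 0 B D) = detSq A * detSq D := by
  rw [detSq_eq _ (Equiv.sumCongr e₁ e₂), detSq_eq A e₁, detSq_eq D e₂, ← mul_pow,
    ← Matrix.det_fromBlocks_zero₁₂ _ (B.submatrix e₂ id)]
  congr 2
  ext (i | i) (j | j) <;> rfl

theorem detSq_one : detSq (1 : Matrix n n ℝ) = 1 := by
  simp [detSq]

theorem detSq_of_isEmpty [IsEmpty n] (M : Matrix m n ℝ) : detSq M = 1 :=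
  Matrix.det_isEmpty

theorem detSq_toMatrix_ne_zero {V W : Type*} [AddCommGroup V] [Module ℝ V] [AddCommGroup W]
    [Module ℝ W] (b : Module.Basis n ℝ V) (c : Module.Basis m ℝ W) (f : V →ₗ[ℝ] W)
    (hf : Function.Bijective f) : detSq (LinearMap.toMatrix b c f) ≠ 0 := by
  classical
  let F := LinearEquiv.ofBijective f hf
  let e : n ≃ m := (b.map F).indexEquiv c
  have h : (LinearMap.toMatrix c b F.symm.toLinearMap) * (LinearMap.toMatrix b c f) = 1 := by
    rw [← LinearMap.toMatrix_comp b c b]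
    convert LinearMap.toMatrix_id b
    ext x
    exact F.symm_apply_apply x
  have h2 := detSq_mul e (LinearMap.toMatrix c b F.symm.toLinearMap) (LinearMap.toMatrix b c f)
  rw [h, detSq_one] at h2
  exact right_ne_zero_of_mul (h2 ▸ one_ne_zero)

/-- The cardinality of the cokernel of an injective square integer matrix. -/
theorem card_quotient_range_mulVecLin (e : n ≃ m) (Q : Matrix m n ℤ)
    (hQ : Function.Injective Q.mulVecLin) :
    ((Nat.card ((m → ℤ) ⧸ LinearMap.range Q.mulVecLin) : ℝ)) ^ 2 =
        detSq (Q.map (Int.cast : ℤ → ℝ)) ∧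
      Nat.card ((m → ℤ) ⧸ LinearMap.range Q.mulVecLin) ≠ 0 := by
  classical
  let F := LinearEquiv.ofInjective Q.mulVecLin hQ
  let G : (m → ℤ) ≃ₗ[ℤ] (n → ℤ) := LinearEquiv.funCongrLeft ℤ ℤ e
  have h := Submodule.natAbs_det_equiv (LinearMap.range Q.mulVecLin) (G.trans F)
  have h1 : (LinearMap.range Q.mulVecLin).subtype ∘ₗ
      AddMonoidHom.toIntLinearMap ((G.trans F : (m → ℤ) ≃ₗ[ℤ] _) : (m → ℤ) →+ _) =
      Matrix.toLin' (Q.submatrix id e.symm) := by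
    refine LinearMap.ext fun x => ?_
    rw [Matrix.toLin'_apply, Matrix.submatrix_mulVec_equiv]
    rfl
  rw [h1, LinearMap.det_toLin'] at h
  have h2 : detSq (Q.map (Int.cast : ℤ → ℝ)) = (((Q.submatrix id e.symm).det : ℤ) : ℝ) ^ 2 := by
    rw [detSq_eq _ e, ← Matrix.det_submatrix_equiv_self e (Q.submatrix id e.symm),
      Int.cast_det]
    congr 2
    ext i j
    simp
  refine ⟨?_, ?_⟩
  · rw [← h, h2, Nat.cast_natAbs]
    push_cast
    rw [sq_abs]
  · rw [← h]
    intro h0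
    have hdet := Int.natAbs_eq_zero.1 h0
    rw [← Matrix.det_submatrix_equiv_self e] at hdet
    obtain ⟨x, hx, hx0⟩ := Matrix.exists_mulVec_eq_zero_iff.2 hdet
    refine hx (hQ ?_)
    rw [map_zero]
    have : (Q.submatrix e id).mulVec x = 0 := by
      rw [← hx0]
      congr 1
      ext i j
      simp
    funext i
    have := congrFun this (e.symm i)
    simpa [Matrix.mulVec, dotProduct] using this

end DetSq

/-! ### Torsion subgroups and quotients -/

section Torsion

/-- With finite kernel, every preimage of a torsion element is torsion, so 0 → ker f → Tor G → Tor H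
→ 0 is exact. -/
theorem card_torsion_eq {G H : Type*} [AddCommGroup G] [AddCommGroup H] (f : G →+ H)
    (hf : Function.Surjective f) [Finite f.ker] :
    Nat.card (AddCommGroup.torsion G) = Nat.card (AddCommGroup.torsion H) * Nat.card f.ker := by
  have hker : ∀ g, f g = 0 → IsOfFinAddOrder g := fun g hg =>
    AddMonoidHom.isOfFinAddOrder f.ker.subtype (isOfFinAddOrder_of_finite (⟨g, hg⟩ : f.ker))
  let F : AddCommGroup.torsion G →+ AddCommGroup.torsion H :=
    (f.comp (AddCommGroup.torsion G).subtype).codRestrict _ fun g => AddMonoidHom.isOfFinAddOrder f g.2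
  have hF : Function.Surjective F := by
    rintro ⟨x, hx⟩
    obtain ⟨g, rfl⟩ := hf x
    refine ⟨⟨g, ?_⟩, rfl⟩
    obtain ⟨n, hn, hx⟩ := isOfFinAddOrder_iff_nsmul_eq_zero.1 hx
    rw [← map_nsmul] at hx
    obtain ⟨k, hk, hx'⟩ := isOfFinAddOrder_iff_nsmul_eq_zero.1 (hker _ hx)
    rw [smul_smul] at hx'
    exact isOfFinAddOrder_iff_nsmul_eq_zero.2 ⟨k * n, Nat.mul_pos hk hn, hx'⟩
  rw [AddSubgroup.card_eq_card_quotient_mul_card_addSubgroup F.ker,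
    Nat.card_congr (QuotientAddGroup.quotientKerEquivOfSurjective F hF).toEquiv]
  congr 1
  refine Nat.card_congr ⟨fun x => ⟨x.1.1, congrArg Subtype.val x.2⟩,
    fun x => ⟨⟨x.1, hker _ x.2⟩, Subtype.ext x.2⟩, fun _ => rfl, fun _ => rfl⟩

theorem finite_torsion (G : Type*) [AddCommGroup G] [Module.Finite ℤ G] :
    Finite (AddCommGroup.torsion G) := by
  have : Module.Finite ℤ (AddCommGroup.torsion G).toIntSubmodule := inferInstance
  have h : Module.Finite ℤ (AddCommGroup.torsion G) := this
  have := Module.Finite.iff_addGroup_fg.1 h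
  refine AddCommGroup.finite_of_fg_isAddTorsion _ ?_
  exact fun x => AddSubmonoid.isOfFinAddOrder_coe.1 x.2

theorem card_eq_of_ker_eq {R M N N' : Type*} [Ring R] [AddCommGroup M] [AddCommGroup N]
    [AddCommGroup N'] [Module R M] [Module R N] [Module R N'] (f : M →ₗ[R] N) (g : M →ₗ[R] N')
    (hf : Function.Surjective f) (hg : Function.Surjective g)
    (h : ∀ x, f x = 0 ↔ g x = 0) : Nat.card N = Nat.card N' := by
  have hk : LinearMap.ker f = LinearMap.ker g := by
    ext x
    exact h x
  exact Nat.card_congr (((f.quotKerEquivOfSurjective hf).symm.trans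
    (Submodule.quotEquivOfEq _ _ hk)).trans (g.quotKerEquivOfSurjective hg)).toEquiv

end Torsion

/-! ### Dimensions of chain spaces -/

section Dimensions

open Classical

universe u

variable {X : Type u} [TopologicalSpace X] [T2Space X] {C : Set X} [CWComplex C]
  [CWComplex.Finite C]

/-- Extension by zero from a subset. -/
def extendZero {K R : Type*} [Zero R] (S : Set K) (g : S → R) (e : K) : R :=
  if h : e ∈ S then g ⟨e, h⟩ else 0

theorem extendZero_coe {K R : Type*} [Zero R] (S : Set K) (g : S → R) (e : S) :
    extendZero S g e = g e := dif_pos e.2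

theorem extendZero_of_notMem {K R : Type*} [Zero R] (S : Set K) (g : S → R) {e : K}
    (he : e ∉ S) : extendZero S g e = 0 := dif_neg he

theorem sum_mul_of_supported {K R : Type*} [Fintype K] [CommRing R] (S : Set K) (f c : K → R)
    (hc : ∀ e ∉ S, c e = 0) : ∑ e, f e * c e = ∑ e : S, f e * c e := by
  rw [← Fintype.sum_subtype_add_sum_subtype (· ∈ S) fun e => f e * c e]
  rw [Finset.sum_eq_zero (s := (Finset.univ : Finset {e // e ∉ S})), add_zero]
  intro e _
  rw [hc _ e.2, mul_zero]

theorem boundary_extendZero {R : Type} [CommRing R] {k : ℕ} (S : Set (cell C (k + 1)))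
    (g : S → R) (e' : cell C k) :
    boundary C R k (extendZero S g) e' = ∑ e : S, (boundaryMatrix C k e' e : R) * g e := by
  rw [boundary_apply, sum_mul_of_supported S _ _ fun e he => extendZero_of_notMem S g he]
  simp only [extendZero_coe]

/-- Chains of a subcomplex are functions on its cells. -/
def chainsEquiv (R : Type) [CommRing R] (E : Subcomplex C) (k : ℕ) :
    chains R E k ≃ₗ[R] (E.I k → R) where
  toFun c e := c.1 e
  map_add' _ _ := rfl
  map_smul' _ _ := rfl
  invFun g := ⟨extendZero (E.I k) g, fun _ he => extendZero_of_notMem _ g he⟩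
  left_inv c := Subtype.ext <| funext fun e => by
    change extendZero (E.I k) (fun e => c.1 e) e = c.1 e
    by_cases he : e ∈ E.I k
    · exact extendZero_coe _ _ ⟨e, he⟩
    · exact (extendZero_of_notMem _ _ he).trans (c.2 e he).symm
  right_inv g := funext fun e => extendZero_coe _ g e

theorem finrank_chains (E : Subcomplex C) (k : ℕ) :
    Module.finrank ℝ (chains ℝ E k) = Fintype.card (E.I k) := by
  rw [(chainsEquiv ℝ E k).finrank_eq, Module.finrank_fintype_fun_eq_card]

theorem finrank_homology (E : Subcomplex C) (k : ℕ) :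
    Module.finrank ℝ (Homology ℝ E k) + Module.finrank ℝ (boundaries ℝ E k) =
      Module.finrank ℝ (cycles ℝ E k) := by
  rw [← Submodule.finrank_quotient_add_finrank
    ((boundaries ℝ E k).submoduleOf (cycles ℝ E k)),
    (Submodule.submoduleOfEquivOfLe (boundaries_le_cycles ℝ E k)).finrank_eq]

theorem finrank_cycles_succ (E : Subcomplex C) (k : ℕ) :
    Module.finrank ℝ (cycles ℝ E (k + 1)) + Module.finrank ℝ (boundaries ℝ E k) =
      Fintype.card (E.I (k + 1)) := by
  rw [← finrank_chains, ← LinearMap.finrank_range_add_finrank_ker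
    ((boundary C ℝ k).domRestrict (chains ℝ E (k + 1))), add_comm]
  congr 1
  · rw [LinearMap.range_domRestrict]
    rfl
  · have h : LinearMap.ker ((boundary C ℝ k).domRestrict (chains ℝ E (k + 1))) =
        (cycles ℝ E (k + 1)).submoduleOf (chains ℝ E (k + 1)) := by
      ext c
      exact ⟨fun hc => ⟨c.2, hc⟩, fun hc => hc.2⟩
    rw [h, (Submodule.submoduleOfEquivOfLe (cycles_le_chains ℝ E (k + 1))).finrank_eq]

/-! ### Spanning trees -/

section Tree

variable {k : ℕ} {T : Subcomplex C}

theorem IsSpanningTree.I_eq_univ (hT : IsSpanningTree k T) : T.I k = Set.univ :=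
  Set.univ_subset_iff.1 ((skeleton_I_eq_univ le_rfl).symm.subset.trans (I_mono hT.skeleton_le k))

theorem IsSpanningTree.I_eq_empty (hT : IsSpanningTree k T) : T.I (k + 2) = ∅ :=
  Set.subset_empty_iff.1 ((I_mono hT.le_skeleton _).trans
    (skeleton_I_eq_empty (Nat.lt_succ_self _)).subset)

/-- T has no (k+2)-cells, so vanishing of H_{k+1}(T;ℤ) means that ∂ is injective on C_{k+1}(T;ℤ). -/
theorem IsSpanningTree.eq_zero (hT : IsSpanningTree k T) {c : Chains C ℤ (k + 1)}
    (hc : c ∈ chains ℤ T (k + 1)) (h : boundary C ℤ k c = 0) : c = 0 := by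
  have := hT.homology_eq_zero
  have h0 : (Submodule.Quotient.mk ⟨c, hc, h⟩ : Homology ℤ T (k + 1)) = 0 := Subsingleton.elim _ _
  rw [Submodule.Quotient.mk_eq_zero] at h0
  have h1 : c ∈ boundaries ℤ T (k + 1) := h0
  rwa [boundaries_eq_bot ℤ hT.I_eq_empty, Submodule.mem_bot] at h1

theorem IsSpanningTree.linearIndependent_int (hT : IsSpanningTree k T) :
    LinearIndependent ℤ fun (e : T.I (k + 1)) (e' : cell C k) => boundaryMatrix C k e' e := by
  rw [Fintype.linearIndependent_iff]
  intro g hg e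
  have h0 : extendZero (T.I (k + 1)) g = 0 := by
    refine hT.eq_zero (fun e he => extendZero_of_notMem _ g he) (funext fun e' => ?_)
    rw [boundary_extendZero]
    have := congrFun hg e'
    simp only [Finset.sum_apply, Pi.smul_apply, smul_eq_mul, Pi.zero_apply] at this ⊢
    rw [← this]
    exact Finset.sum_congr rfl fun _ _ => by rw [Int.cast_id, mul_comm]
  rw [← extendZero_coe _ g e, h0]
  rfl

theorem IsSpanningTree.linearIndependent_real (hT : IsSpanningTree k T) :
    LinearIndependent ℝ fun (e : T.I (k + 1)) (e' : cell C k) =>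
      (boundaryMatrix C k e' e : ℝ) :=
  (linearIndependent_algebraMap_comp_iff (R := ℤ) (S := ℝ)).2 hT.linearIndependent_int

theorem boundaries_eq_whole {E : Subcomplex C} {k : ℕ} (h : E.I (k + 1) = Set.univ) (R : Type)
    [CommRing R] : boundaries R E k = boundaries R (whole C) k := by
  rw [boundaries, boundaries, chains_eq_top R h, chains_eq_top R (E := whole C) rfl]

theorem cycles_eq_whole {E : Subcomplex C} {k : ℕ} (h : E.I k = Set.univ) (R : Type)
    [CommRing R] : cycles R E k = cycles R (whole C) k :=
  le_antisymm (cycles_le_whole R E k) (cycles_mono R (by rw [h]; exact Set.subset_univ _))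

theorem boundaries_le_whole (E : Subcomplex C) (k : ℕ) (R : Type) [CommRing R] :
    boundaries R E k ≤ boundaries R (whole C) k := boundaries_mono R (Set.subset_univ _)

/-- T contains all k-cells, so it has the same k-cycles as the (k+1)-skeleton. Equal Betti numbers
then give boundary spaces of equal dimension, one inside the other. -/
theorem IsSpanningTree.boundaries_eq (hT : IsSpanningTree k T) :
    boundaries ℝ T k = boundaries ℝ (whole C) k := by
  have h1 := finrank_homology T k
  have h2 := finrank_homology (skeleton C ((k + 1 : ℕ) : ℕ∞)) k
  have h3 := hT.betti_eq
  rw [betti, betti] at h3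
  have h4 := congrArg (fun S : Submodule ℝ _ => Module.finrank ℝ S)
    (cycles_eq_whole hT.I_eq_univ ℝ)
  have h5 := congrArg (fun S : Submodule ℝ _ => Module.finrank ℝ S)
    (cycles_eq_whole (C := C) (skeleton_I_eq_univ (by omega : k ≤ k + 1)) ℝ)
  have h6 := congrArg (fun S : Submodule ℝ _ => Module.finrank ℝ S)
    (boundaries_eq_whole (C := C) (skeleton_I_eq_univ (le_refl (k + 1))) ℝ)
  exact Submodule.eq_of_le_of_finrank_eq (boundaries_le_whole T k ℝ) (by omega)

theorem boundary_mem_whole {R : Type} [CommRing R] {k : ℕ} (c : Chains C R (k + 1)) :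
    boundary C R k c ∈ boundaries R (whole C) k :=
  Submodule.mem_map_of_mem fun e he => absurd (Set.mem_univ e) he

/-- The boundary of a cell. -/
def cellBoundary {k : ℕ} (e : cell C (k + 1)) : boundaries ℝ (whole C) k :=
  ⟨boundary C ℝ k (Pi.single e 1), boundary_mem_whole _⟩

theorem cellBoundary_apply {k : ℕ} (e : cell C (k + 1)) (e' : cell C k) :
    (cellBoundary e).1 e' = boundaryMatrix C k e' e := by
  change boundary C ℝ k (Pi.single e 1) e' = _
  rw [boundary_apply]
  simp [Pi.single_apply]

/-- The boundaries of the cells of a spanning tree form a basis of the boundaries. -/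
def IsSpanningTree.basis (hT : IsSpanningTree k T) :
    Module.Basis (T.I (k + 1)) ℝ (boundaries ℝ (whole C) k) :=
  .mk (v := fun e => cellBoundary e.1)
    (.of_comp (boundaries ℝ (whole C) k).subtype <| by
      convert hT.linearIndependent_real using 1
      funext e e'
      exact cellBoundary_apply e.1 e')
    (by
      rintro ⟨_, hb⟩ -
      rw [← hT.boundaries_eq] at hb
      obtain ⟨c, hc, rfl⟩ := hb
      have : (⟨boundary C ℝ k c, boundary_mem_whole c⟩ :
          boundaries ℝ (whole C) k) = ∑ e : T.I (k + 1), c e • cellBoundary e.1 := by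
        refine Subtype.ext (funext fun e' => ?_)
        change boundary C ℝ k c e' = _
        rw [boundary_apply, sum_mul_of_supported (T.I (k + 1)) _ _ hc]
        simp only [Submodule.coe_sum, Submodule.coe_smul, Finset.sum_apply, Pi.smul_apply,
          cellBoundary_apply, smul_eq_mul, mul_comm]
      exact this ▸ Submodule.sum_mem _ fun e _ => Submodule.smul_mem _ _
        (Submodule.subset_span ⟨e, rfl⟩))

theorem IsSpanningTree.basis_apply (hT : IsSpanningTree k T) (e : T.I (k + 1)) :
    hT.basis e = cellBoundary e.1 := by
  rw [basis, Module.Basis.mk_apply]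

theorem IsSpanningTree.card_eq (hT : IsSpanningTree k T) :
    Fintype.card (T.I (k + 1)) = Module.finrank ℝ (boundaries ℝ (whole C) k) :=
  (Module.finrank_eq_card_basis hT.basis).symm

end Tree
end Dimensions

/-! ### Homology truncations -/

section Truncation

open Classical

universe u

variable {X : Type u} [TopologicalSpace X] [T2Space X] {C : Set X} [CWComplex C]
  [CWComplex.Finite C] {k : ℕ} {T V : Subcomplex C}

theorem IsHomologyTruncation.I_eq_empty (hV : IsHomologyTruncation k T V) : V.I (k + 1) = ∅ :=
  Set.subset_empty_iff.1 ((I_mono hV.le_skeleton _).trans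
    (skeleton_I_eq_empty (Nat.lt_succ_self _)).subset)

theorem IsHomologyTruncation.I_subset (hV : IsHomologyTruncation k T V) (n : ℕ) : T.I n ⊆ V.I n :=
  I_mono hV.tree_le n

theorem IsHomologyTruncation.mem_boundaries (hV : IsHomologyTruncation k T V) {R : Type}
    [CommRing R] {c : Chains C R k} (hc : c ∈ boundaries R V k) : c = 0 := by
  rwa [boundaries_eq_bot R hV.I_eq_empty, Submodule.mem_bot] at hc

theorem IsHomologyTruncation.mk_injective (hV : IsHomologyTruncation k T V) :
    Function.Injective (Submodule.mkQ ((boundaries ℝ V k).submoduleOf (cycles ℝ V k))) := by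
  rw [← LinearMap.ker_eq_bot, Submodule.ker_mkQ, Submodule.eq_bot_iff]
  exact fun c hc => Subtype.ext (hV.mem_boundaries hc)

/-- A real cycle of the truncation bounding in the whole complex is zero. -/
theorem IsHomologyTruncation.eq_zero (hV : IsHomologyTruncation k T V) {c : Chains C ℝ k}
    (hc : c ∈ cycles ℝ V k) (hb : c ∈ boundaries ℝ (whole C) k) : c = 0 := by
  have h : inclHomology ℝ V k (Submodule.Quotient.mk ⟨c, hc⟩) = 0 := by
    refine (Submodule.Quotient.mk_eq_zero _).2 ?_
    exact hb
  have h2 := (hV.bijective k le_rfl).1 (h.trans (map_zero _).symm)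
  exact congrArg Subtype.val (hV.mk_injective (h2.trans (map_zero (Submodule.mkQ _)).symm))

theorem realChain_injective (k : ℕ) : Function.Injective (realChain (C := C) k) := fun a b h =>
  funext fun e => by
    have : (a e : ℝ) = b e := congrFun h e
    exact_mod_cast this

section Lattice

variable {κ : Type*} [Fintype κ] (v : Module.Basis κ ℝ (Homology ℝ V k))

theorem IsCombinatorialBasis.exists_rep (hv : IsCombinatorialBasis v) (j : κ) :
    ∃ z : cycles ℤ V k, realHomology V k (Submodule.Quotient.mk z) = v j := by
  have : v j ∈ (realHomology V k).range := by
    rw [← hv]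
    exact AddSubgroup.subset_closure ⟨j, rfl⟩
  obtain ⟨x, hx⟩ := this
  obtain ⟨z, rfl⟩ := Submodule.Quotient.mk_surjective _ x
  exact ⟨z, hx⟩

/-- Integral cycles representing a combinatorial basis. -/
def IsCombinatorialBasis.rep {v : Module.Basis κ ℝ (Homology ℝ V k)} (hv : IsCombinatorialBasis v)
    (j : κ) : cycles ℤ V k := (hv.exists_rep v j).choose

theorem IsCombinatorialBasis.mk_rep {v : Module.Basis κ ℝ (Homology ℝ V k)}
    (hv : IsCombinatorialBasis v) (j : κ) :
    (Submodule.Quotient.mk (realCycle V k (hv.rep j)) : Homology ℝ V k) = v j :=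
  (hv.exists_rep v j).choose_spec

variable {v}

/-- Since B_k(V) = 0, the integral homology of V in degree k is Z_k(V;ℤ) and embeds in the real one.
A basis of the lattice is therefore a ℤ-basis of the integral cycles themselves. -/
theorem IsCombinatorialBasis.exists_eq_sum (hV : IsHomologyTruncation k T V)
    (hv : IsCombinatorialBasis v) (c : cycles ℤ V k) :
    ∃ g : κ → ℤ, c = ∑ j, g j • hv.rep j := by
  have h : realHomology V k (Submodule.Quotient.mk c) ∈ AddSubgroup.closure (Set.range v) := by
    rw [show AddSubgroup.closure (Set.range v) = _ from hv]
    exact ⟨_, rfl⟩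
  rw [← Submodule.span_int_eq_addSubgroupClosure, Submodule.mem_toAddSubgroup,
    Submodule.mem_span_range_iff_exists_fun] at h
  obtain ⟨g, hg⟩ := h
  refine ⟨g, Subtype.ext (realChain_injective k ?_)⟩
  have h1 : (Submodule.mkQ ((boundaries ℝ V k).submoduleOf (cycles ℝ V k)))
      (realCycle V k (∑ j, g j • hv.rep j)) = Submodule.mkQ _ (realCycle V k c) := by
    refine Eq.trans ?_ hg
    rw [map_sum, map_sum]
    refine Finset.sum_congr rfl fun j _ => ?_
    rw [map_zsmul, map_zsmul]
    exact congrArg _ (hv.mk_rep j)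
  exact congrArg Subtype.val (hV.mk_injective h1).symm

theorem IsCombinatorialBasis.eq_zero_of_sum_eq_zero
    (hv : IsCombinatorialBasis v) (g : κ → ℤ) (h : ∑ j, g j • hv.rep j = 0) : g = 0 := by
  have h1 : ∑ j, (g j : ℝ) • v j = 0 := by
    have := congrArg (fun c => Submodule.mkQ ((boundaries ℝ V k).submoduleOf (cycles ℝ V k))
      (realCycle V k c)) h
    simp only [map_sum, map_zsmul, map_zero] at this
    rw [← this]
    refine Finset.sum_congr rfl fun j _ => ?_
    rw [← hv.mk_rep j, Int.cast_smul_eq_zsmul]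
    rfl
  funext j
  have := Fintype.linearIndependent_iff.1 v.linearIndependent _ h1 j
  exact_mod_cast this

/-- The restriction of the integral cycles to the cells of `V` outside `T`. -/
def IsCombinatorialBasis.cycleMatrix (hv : IsCombinatorialBasis v) (T : Subcomplex C) :
    Matrix {e // e ∈ V.I k ∧ e ∉ T.I k} κ ℤ := Matrix.of fun e j => (hv.rep j).1 e.1

theorem IsCombinatorialBasis.cycleMatrix_mulVec (hv : IsCombinatorialBasis v) (T : Subcomplex C)
    (g : κ → ℤ) (e : {e // e ∈ V.I k ∧ e ∉ T.I k}) :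
    (hv.cycleMatrix T).mulVecLin g e = (∑ j, g j • hv.rep j : cycles ℤ V k).1 e.1 := by
  simp only [Matrix.mulVecLin_apply, Matrix.mulVec, dotProduct, Submodule.coe_sum,
    Submodule.coe_smul, Finset.sum_apply, Pi.smul_apply, smul_eq_mul, mul_comm (g _)]
  rfl

end Lattice
end Truncation

/-! ### Cardinalities and indices for a family of spanning trees -/

section Family

open Classical

universe u

variable {X : Type u} [TopologicalSpace X] [T2Space X] {C : Set X} [CWComplex C]
  [CWComplex.Finite C] {T V : ℕ → Subcomplex C}

theorem card_tree (hT₀ : (T 0 : Set X) = ∅) (hT : ∀ k, IsSpanningTree k (T (k + 1))) :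
    ∀ k, Fintype.card ((T k).I k) = rankPrev C k
  | 0 => by
    have := I_eq_empty hT₀ 0
    rw [rankPrev, Fintype.card_eq_zero_iff, Set.isEmpty_coe_sort, this]
  | k + 1 => (hT k).card_eq

/-- As soon as E contains the k-cells of the tree, its boundaries in degree k − 1 are all those of
X. -/
theorem finrank_cycles_add_rankPrev (hT : ∀ k, IsSpanningTree k (T (k + 1))) (E : Subcomplex C) :
    ∀ k, (T k).I k ⊆ E.I k →
      Module.finrank ℝ (cycles ℝ E k) + rankPrev C k = Fintype.card (E.I k)
  | 0, _ => finrank_chains E 0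
  | k + 1, h => by
    have h1 : boundaries ℝ E k = boundaries ℝ (whole C) k :=
      le_antisymm (boundaries_le_whole E k ℝ) ((hT k).boundaries_eq ▸ boundaries_mono ℝ h)
    rw [rankPrev, ← h1, finrank_cycles_succ]

variable (hT₀ : (T 0 : Set X) = ∅) (hT : ∀ k, IsSpanningTree k (T (k + 1)))
  (hV : ∀ k, IsHomologyTruncation k (T k) (V k))

include hT hV

theorem finrank_homology_truncation (k : ℕ) :
    Module.finrank ℝ (Homology ℝ (V k) k) + rankPrev C k = Fintype.card ((V k).I k) := by
  have h := congrArg (fun S : Submodule ℝ _ => Module.finrank ℝ S)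
    (boundaries_eq_bot ℝ (hV k).I_eq_empty)
  have h1 := finrank_homology (V k) k
  have h2 := finrank_bot ℝ (Chains C ℝ k)
  have h3 := finrank_cycles_add_rankPrev hT (V k) k ((hV k).I_subset k)
  omega

include hT₀

/-- X has dim H_k + dim B_k + dim B_{k-1} cells of dimension k, and V^k has dim H_k + dim B_{k-1}.
The difference dim B_k is the number of (k+1)-cells of T^{k+1}. -/
theorem card_outside (k : ℕ) :
    Fintype.card ((T (k + 1)).I (k + 1)) = Fintype.card {e // e ∉ (V k).I k} := by
  have h1 := finrank_homology_truncation hT hV k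
  have h2 := finrank_cycles_add_rankPrev hT (whole C) k (Set.subset_univ _)
  have h3 := finrank_homology (whole C) k
  have h4 := (LinearEquiv.ofBijective _ ((hV k).bijective k le_rfl)).finrank_eq
  have h5 : Fintype.card ((whole C).I k) = Fintype.card (cell C k) :=
    Fintype.card_congr (Equiv.Set.univ _)
  have h6 := Fintype.card_subtype_compl (· ∈ (V k).I k)
  have h7 := Fintype.card_subtype_le (· ∈ (V k).I k)
  have h8 := card_tree hT₀ hT (k + 1)
  rw [rankPrev] at h8
  change _ = Fintype.card {e // ¬ e ∈ (V k).I k}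
  rw [h6]
  change Fintype.card ((V k).I k) ≤ _ at h7
  change _ = _ - Fintype.card ((V k).I k)
  omega

theorem card_middle (k : ℕ) : Module.finrank ℝ (Homology ℝ (V k) k) =
    Fintype.card {e // e ∈ (V k).I k ∧ e ∉ (T k).I k} := by
  have h1 := finrank_homology_truncation hT hV k
  have h2 := card_tree hT₀ hT k
  have h3 : Fintype.card ((V k).I k) = Fintype.card {e // e ∈ (V k).I k ∧ e ∉ (T k).I k} +
      Fintype.card ((T k).I k) := by
    rw [← Fintype.card_sum]
    refine Fintype.card_congr (Equiv.symm ⟨Sum.elim (fun e => ⟨e.1, e.2.1⟩)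
      (fun e => ⟨e.1, (hV k).I_subset k e.2⟩), fun e =>
        if h : e.1 ∈ (T k).I k then .inr ⟨e.1, h⟩ else .inl ⟨e.1, e.2, h⟩, ?_, ?_⟩)
    · rintro (e | e)
      · simp [e.2.2]
      · simp
    · intro e
      by_cases h : e.1 ∈ (T k).I k <;> simp [h]
  omega

omit hV

theorem cycle_tree_eq_zero : ∀ {k : ℕ} {c : Chains C ℤ k} (_ : c ∈ cycles ℤ (T k) k), c = 0
  | 0, c, hc => by
    have : c ∈ chains ℤ (T 0) 0 := hc
    rwa [chains_eq_bot ℤ (I_eq_empty hT₀ 0), Submodule.mem_bot] at this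
  | k + 1, _, hc => (hT k).eq_zero hc.1 hc.2

variable {k : ℕ} {κ : Type*} [Fintype κ] {v : Module.Basis κ ℝ (Homology ℝ (V k) k)}

theorem IsCombinatorialBasis.cycleMatrix_injective (hv : IsCombinatorialBasis v) :
    Function.Injective (hv.cycleMatrix (T k)).mulVecLin := by
  rw [← LinearMap.ker_eq_bot, Submodule.eq_bot_iff]
  intro g hg
  refine hv.eq_zero_of_sum_eq_zero g (Subtype.ext (cycle_tree_eq_zero hT₀ hT ?_))
  refine mem_cycles_of_le ℤ (Subtype.prop _) fun e he => ?_
  by_cases heV : e ∈ (V k).I k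
  · exact (hv.cycleMatrix_mulVec (T k) g ⟨e, heV, he⟩).symm.trans (congrFun hg _)
  · exact cycles_le_chains ℤ (V k) k (Subtype.prop _) e heV

end Family

/-! ### Torsion orders of trees and truncations -/

section Theta

open Classical

universe u

variable {X : Type u} [TopologicalSpace X] [T2Space X] {C : Set X} [CWComplex C]
  [CWComplex.Finite C] {k : ℕ} {T V : Subcomplex C} {κ : Type*} [Fintype κ]

/-- Restriction of chains to the cells of `V` outside `T`, modulo the cycles. -/
def toMiddle {v : Module.Basis κ ℝ (Homology ℝ V k)} (hv : IsCombinatorialBasis v)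
    (T : Subcomplex C) :
    chains ℤ V k →ₗ[ℤ] ({e // e ∈ V.I k ∧ e ∉ T.I k} → ℤ) ⧸
      LinearMap.range (hv.cycleMatrix T).mulVecLin :=
  Submodule.mkQ _ ∘ₗ LinearMap.funLeft ℤ ℤ Subtype.val ∘ₗ (chains ℤ V k).subtype

theorem toMiddle_surjective {v : Module.Basis κ ℝ (Homology ℝ V k)} (hv : IsCombinatorialBasis v)
    (T : Subcomplex C) : Function.Surjective (toMiddle hv T) := by
  intro x
  obtain ⟨g, rfl⟩ := Submodule.Quotient.mk_surjective _ x
  refine ⟨⟨extendZero {e | e ∈ V.I k ∧ e ∉ T.I k} g, fun e he =>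
    extendZero_of_notMem _ _ fun h => he h.1⟩, ?_⟩
  exact congrArg (Submodule.Quotient.mk) (funext fun e => extendZero_coe _ g e)

/-- The cokernel of the cycle matrix is thereby C_k(V)/(Z_k(V) + C_k(T)). -/
theorem toMiddle_eq_zero_iff {v : Module.Basis κ ℝ (Homology ℝ V k)}
    (hV : IsHomologyTruncation k T V) (hv : IsCombinatorialBasis v) (c : chains ℤ V k) :
    toMiddle hv T c = 0 ↔ ∃ z ∈ cycles ℤ V k, c.1 - z ∈ chains ℤ T k := by
  have h : toMiddle hv T c = 0 ↔ (fun e : {e // e ∈ V.I k ∧ e ∉ T.I k} => c.1 e) ∈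
      LinearMap.range (hv.cycleMatrix T).mulVecLin := Submodule.Quotient.mk_eq_zero _
  rw [h]
  constructor
  · rintro ⟨g, hg⟩
    refine ⟨_, (∑ j, g j • hv.rep j).2, fun e he => ?_⟩
    by_cases heV : e ∈ V.I k
    · have h1 := congrFun hg ⟨e, heV, he⟩
      rw [hv.cycleMatrix_mulVec] at h1
      exact sub_eq_zero.2 h1.symm
    · exact (chains ℤ V k).sub_mem c.2 (cycles_le_chains ℤ V k (Subtype.prop _)) e heV
  · rintro ⟨z, hz, hcz⟩
    obtain ⟨g, hg⟩ := hv.exists_eq_sum hV ⟨z, hz⟩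
    refine ⟨g, funext fun e => ?_⟩
    rw [hv.cycleMatrix_mulVec, ← hg]
    exact (sub_eq_zero.1 (hcz e.1 e.2.2)).symm

/-- Every 0-chain is a cycle. This agrees with the convention θ = 1 in degree 0. -/
theorem card_middle_quotient_zero {v : Module.Basis κ ℝ (Homology ℝ V 0)}
    (hV : IsHomologyTruncation 0 T V) (hv : IsCombinatorialBasis v) :
    Nat.card (({e // e ∈ V.I 0 ∧ e ∉ T.I 0} → ℤ) ⧸
      LinearMap.range (hv.cycleMatrix T).mulVecLin) = 1 := by
  rw [Nat.card_eq_one_iff_unique]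
  refine ⟨⟨fun a b => ?_⟩, ⟨0⟩⟩
  obtain ⟨a, rfl⟩ := toMiddle_surjective hv T a
  obtain ⟨b, rfl⟩ := toMiddle_surjective hv T b
  have h : ∀ c, toMiddle hv T c = 0 := fun c => (toMiddle_eq_zero_iff hV hv c).2
    ⟨c.1, c.2, by rw [sub_self]; exact Submodule.zero_mem _⟩
  rw [h, h]

theorem finite_torsion_homology (E : Subcomplex C) (k : ℕ) :
    Finite (AddCommGroup.torsion (Homology ℤ E k)) :=
  finite_torsion _

theorem theta_ne_zero (E : Subcomplex C) : ∀ k, theta E k ≠ 0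
  | 0 => one_ne_zero
  | k + 1 => by
    have := finite_torsion_homology E k
    exact Nat.card_pos.ne'

/-- T contains all k-cells, so T and V have the same k-cycles and H_k(T;ℤ) → H_k(V;ℤ) is onto with
kernel B_k(V)/B_k(T). The boundary identifies this kernel with C_{k+1}(V)/(Z_{k+1}(V) + C_{k+1}(T)),
the finite cokernel of the cycle matrix. -/
theorem theta_succ {v : Module.Basis κ ℝ (Homology ℝ V (k + 1))} (hT : IsSpanningTree k T)
    (hV : IsHomologyTruncation (k + 1) T V) (hv : IsCombinatorialBasis v)
    (hne : Nat.card (({e // e ∈ V.I (k + 1) ∧ e ∉ T.I (k + 1)} → ℤ) ⧸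
      LinearMap.range (hv.cycleMatrix T).mulVecLin) ≠ 0) :
    theta T (k + 1) = theta V (k + 1) *
      Nat.card (({e // e ∈ V.I (k + 1) ∧ e ∉ T.I (k + 1)} → ℤ) ⧸
        LinearMap.range (hv.cycleMatrix T).mulVecLin) := by
  have hTV : cycles ℤ V k ≤ cycles ℤ T k :=
    cycles_mono ℤ (by rw [hT.I_eq_univ]; exact Set.subset_univ _)
  let π : Homology ℤ T k →ₗ[ℤ] Homology ℤ V k :=
    Submodule.mapQ _ _ (Submodule.inclusion (cycles_mono ℤ (hV.I_subset k))) fun _ hx =>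
      boundaries_mono ℤ (hV.I_subset (k + 1)) hx
  have hπ : Function.Surjective π := by
    intro x
    obtain ⟨z, rfl⟩ := Submodule.Quotient.mk_surjective _ x
    exact ⟨Submodule.Quotient.mk ⟨z.1, hTV z.2⟩, rfl⟩
  let d : chains ℤ V (k + 1) →ₗ[ℤ] cycles ℤ T k :=
    ((boundary C ℤ k).domRestrict (chains ℤ V (k + 1))).codRestrict _ fun c =>
      hTV (boundaries_le_cycles ℤ V k ⟨c.1, c.2, rfl⟩)
  have hker : ∀ c, π (Submodule.Quotient.mk (d c)) = 0 := fun c =>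
    (Submodule.Quotient.mk_eq_zero _).2 ⟨c.1, c.2, rfl⟩
  let f : chains ℤ V (k + 1) →ₗ[ℤ] LinearMap.ker π := (Submodule.mkQ _ ∘ₗ d).codRestrict _ hker
  have hf : Function.Surjective f := by
    rintro ⟨x, hx⟩
    obtain ⟨z, rfl⟩ := Submodule.Quotient.mk_surjective _ x
    obtain ⟨c, hc, hcz⟩ := (Submodule.Quotient.mk_eq_zero _).1 (LinearMap.mem_ker.1 hx)
    refine ⟨⟨c, hc⟩, Subtype.ext (congrArg Submodule.Quotient.mk (Subtype.ext ?_))⟩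
    exact hcz
  have hcard := card_eq_of_ker_eq (toMiddle hv T) f (toMiddle_surjective hv T) hf fun c => by
    rw [toMiddle_eq_zero_iff hV hv]
    have : f c = 0 ↔ boundary C ℤ k c.1 ∈ boundaries ℤ T k := by
      rw [← Submodule.coe_eq_zero]
      exact Submodule.Quotient.mk_eq_zero _
    rw [this]
    constructor
    · rintro ⟨z, hz, hcz⟩
      refine ⟨_, hcz, ?_⟩
      rw [map_sub, LinearMap.mem_ker.1 hz.2, sub_zero]
    · rintro ⟨c', hc', h⟩
      refine ⟨c.1 - c', ⟨(chains ℤ V (k + 1)).sub_mem c.2 (chains_mono ℤ (hV.I_subset _) hc'), ?_⟩, ?_⟩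
      · exact (map_sub _ _ _).trans (sub_eq_zero.2 h.symm)
      · rwa [sub_sub_cancel]
  rw [hcard] at hne ⊢
  have : Finite (LinearMap.ker π) := Nat.finite_of_card_ne_zero hne
  have : Finite π.toAddMonoidHom.ker := this
  exact card_torsion_eq π.toAddMonoidHom hπ

end Theta

/-! ### The relative boundary matrix -/

section Outside

open Classical

universe u

variable {X : Type u} [TopologicalSpace X] [T2Space X] {C : Set X} [CWComplex C]
  [CWComplex.Finite C] {k : ℕ} {T T' V : Subcomplex C}

/-- The boundary matrix from the cells of `T'` to the cells outside `V`. -/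
def outsideMatrix (T' V : Subcomplex C) (k : ℕ) :
    Matrix {e // e ∉ V.I k} (T'.I (k + 1)) ℤ := Matrix.of fun e e' => boundaryMatrix C k e.1 e'.1

theorem outsideMatrix_mulVec (T' V : Subcomplex C) (k : ℕ) (g : T'.I (k + 1) → ℤ)
    (e : {e // e ∉ V.I k}) : (outsideMatrix T' V k).mulVecLin g e =
      boundary C ℤ k (extendZero (T'.I (k + 1)) g) e.1 := by
  rw [boundary_extendZero]
  simp only [Int.cast_id]
  rfl

theorem extendZero_mem_chains (R : Type) [CommRing R] (E : Subcomplex C) (k : ℕ) (g : E.I k → R) :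
    extendZero (E.I k) g ∈ chains R E k := fun _ he => extendZero_of_notMem _ g he

/-- If the boundary of a chain of T' has no cell outside V, it is a cycle of V bounding in X, hence
zero; and ∂ is injective on the chains of T'. -/
theorem outsideMatrix_injective (hT' : IsSpanningTree k T') (hV : IsHomologyTruncation k T V) :
    Function.Injective (outsideMatrix T' V k).mulVecLin := by
  rw [← LinearMap.ker_eq_bot, Submodule.eq_bot_iff]
  intro g hg
  let c : Chains C ℤ (k + 1) := extendZero (T'.I (k + 1)) g
  have hb : boundary C ℤ k c ∈ chains ℤ V k := fun e he =>
    (outsideMatrix_mulVec T' V k g ⟨e, he⟩).symm.trans (congrFun hg _)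
  have hz : boundary C ℤ k c ∈ cycles ℤ V k :=
    mem_cycles_of_le ℤ (boundaries_le_cycles ℤ (whole C) k (boundary_mem_whole c)) hb
  have h0 : realChain k (boundary C ℤ k c) = 0 := by
    refine hV.eq_zero (realChain_mem_cycles V k hz) ?_
    rw [← realChain_boundary]
    exact boundary_mem_whole _
  have h1 := realChain_injective k (h0.trans (map_zero _).symm)
  have h2 := hT'.eq_zero (extendZero_mem_chains ℤ T' (k + 1) g) h1
  funext e
  exact (extendZero_coe _ g e).symm.trans (congrFun h2 e.1)

theorem tq_eq (T' V : Subcomplex C) (k : ℕ) : tq T' V k =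
    Nat.card (({e // e ∉ V.I k} → ℤ) ⧸ LinearMap.range (outsideMatrix T' V k).mulVecLin) := by
  let f : Chains C ℤ k →ₗ[ℤ] ({e // e ∉ V.I k} → ℤ) ⧸
      LinearMap.range (outsideMatrix T' V k).mulVecLin :=
    Submodule.mkQ _ ∘ₗ LinearMap.funLeft ℤ ℤ Subtype.val
  let g : Chains C ℤ k →ₗ[ℤ] (Chains C ℤ k ⧸ chains ℤ V k) ⧸ LinearMap.range (q T' V k) :=
    Submodule.mkQ _ ∘ₗ Submodule.mkQ _
  refine card_eq_of_ker_eq g f ?_ ?_ fun c => ?_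
  · exact (Submodule.mkQ_surjective _).comp (Submodule.mkQ_surjective _)
  · refine (Submodule.mkQ_surjective _).comp fun x =>
      ⟨extendZero {e | e ∉ V.I k} x, funext fun e => extendZero_coe _ x e⟩
  have h1 : f c = 0 ↔ (fun e : {e // e ∉ V.I k} => c e) ∈
      LinearMap.range (outsideMatrix T' V k).mulVecLin := Submodule.Quotient.mk_eq_zero _
  have h2 : g c = 0 ↔ (chains ℤ V k).mkQ c ∈ LinearMap.range (q T' V k) :=
    Submodule.Quotient.mk_eq_zero _
  rw [h1, h2]
  constructor
  · rintro ⟨⟨_, c', hc', rfl⟩, hb⟩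
    have hb' : boundary C ℤ k c' - c ∈ chains ℤ V k := (Submodule.Quotient.eq _).1 hb
    refine ⟨fun e => c' e, funext fun e => ?_⟩
    have h3 : extendZero (T'.I (k + 1)) (fun e => c' e) = c' := funext fun e => by
      by_cases he : e ∈ T'.I (k + 1)
      · exact extendZero_coe _ _ ⟨e, he⟩
      · exact (extendZero_of_notMem _ _ he).trans (hc' e he).symm
    rw [outsideMatrix_mulVec, h3]
    exact sub_eq_zero.1 (hb' e.1 e.2)
  · rintro ⟨x, hx⟩
    refine ⟨⟨_, _, extendZero_mem_chains ℤ T' (k + 1) x, rfl⟩,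
      (Submodule.Quotient.eq _).2 fun e he => ?_⟩
    exact sub_eq_zero.2 ((outsideMatrix_mulVec T' V k x ⟨e, he⟩).symm.trans (congrFun hx _))

end Outside

/-! ### The torsion matrix in terms of trees and truncations -/

section Blocks

open Classical

universe u

variable {X : Type u} [TopologicalSpace X] [T2Space X] {C : Set X} [CWComplex C]
  [CWComplex.Finite C] {T V : ℕ → Subcomplex C} (S : TorsionChoices C)

/-- The coordinates of the boundaries of the cells of the spanning trees. -/
def treeCoords (T : ℕ → Subcomplex C) : ∀ k, Matrix (Fin (rankPrev C k)) ((T k).I k) ℝ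
  | 0 => 0
  | k + 1 => Matrix.of fun i e => (S.b k).repr (cellBoundary e.1) i

theorem sub_lift_mem_cycles (T : ℕ → Subcomplex C) : ∀ (k : ℕ) (e : (T k).I k),
    Pi.single e.1 1 - ∑ i, treeCoords S T k i e • S.lift k i ∈ cycles ℝ (whole C) k
  | 0, _ => fun e he => absurd (Set.mem_univ e) he
  | k + 1, e => by
    refine ⟨fun e he => absurd (Set.mem_univ e) he, LinearMap.mem_ker.2 ?_⟩
    rw [map_sub, map_sum, sub_eq_zero]
    simp only [map_smul, TorsionChoices.lift, S.boundary_s]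
    have := congrArg Subtype.val ((S.b k).sum_repr (cellBoundary e.1))
    rw [Submodule.coe_sum] at this
    exact this.symm

theorem exists_cycle_eq {ι : Type*} [Fintype ι] {k : ℕ}
    (h : Module.Basis ι ℝ (Homology ℝ (whole C) k)) (c : cycles ℝ (whole C) k) :
    ∃ a : Fin (rankPrev C (k + 1)) → ℝ, c.1 = ∑ i, a i • (S.b k i).1 +
      ∑ j, h.repr (Submodule.Quotient.mk c) j • (S.t k (h j)).1 := by
  have h1 : S.t k (Submodule.Quotient.mk c) =
      ∑ j, h.repr (Submodule.Quotient.mk c) j • S.t k (h j) := by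
    conv_lhs => rw [← h.sum_repr (Submodule.Quotient.mk c)]
    simp only [map_sum, map_smul]
  have h2' : c - S.t k (Submodule.Quotient.mk c) ∈
      (boundaries ℝ (whole C) k).submoduleOf (cycles ℝ (whole C) k) :=
    (Submodule.Quotient.eq _).1 (S.mk_t k (Submodule.Quotient.mk c)).symm
  have h2 : c.1 - (S.t k (Submodule.Quotient.mk c)).1 ∈ boundaries ℝ (whole C) k := h2'
  refine ⟨(S.b k).repr ⟨_, h2⟩, ?_⟩
  have h3 := congrArg Subtype.val ((S.b k).sum_repr ⟨_, h2⟩)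
  have h4 := congrArg Subtype.val h1
  rw [Submodule.coe_sum] at h3 h4
  simp only [Submodule.coe_smul] at h3 h4
  exact (sub_add_cancel c.1 _).symm.trans (congrArg₂ _ h3.symm h4)

variable {k : ℕ} {κ : Type*} [Fintype κ] {v : Module.Basis κ ℝ (Homology ℝ (V k) k)}

/-- The chains given by the boundaries of the cells of the next tree, the cycles of the truncation,
and the cells of the tree. -/
def adaptedMatrix (T : ℕ → Subcomplex C) (hv : IsCombinatorialBasis v) :
    Matrix (cell C k) ((T (k + 1)).I (k + 1) ⊕ κ ⊕ (T k).I k) ℝ :=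
  Matrix.of fun e => Sum.elim (fun e' => (boundaryMatrix C k e e'.1 : ℝ))
    (Sum.elim (fun j => ((hv.rep j).1 e : ℝ)) fun e' => (Pi.single e'.1 1 : cell C k → ℝ) e)

/-- Triangularity: a boundary involves 𝔟_k only, a cycle involves 𝔟_k and its homology class, and a
cell minus the lift of its boundary is a cycle. The blocks B and D do not affect the determinant. -/
theorem exists_mul_eq_adaptedMatrix {ι : ℕ → Type*} [∀ k, Fintype (ι k)] [DecidableEq κ]
    (h : ∀ k, Module.Basis (ι k) ℝ (Homology ℝ (whole C) k)) (hv : IsCombinatorialBasis v) :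
    ∃ (B : Matrix (Fin (rankPrev C (k + 1))) (κ ⊕ (T k).I k) ℝ) (D : Matrix (ι k) ((T k).I k) ℝ),
      S.changeOfBasis h k * Matrix.fromBlocks (treeCoords S T (k + 1)) B 0
        (Matrix.fromBlocks (LinearMap.toMatrix v (h k) (inclHomology ℝ (V k) k)) D 0
          (treeCoords S T k)) = adaptedMatrix T hv := by
  let z : κ → cycles ℝ (whole C) k := fun j =>
    ⟨_, cycles_le_whole ℝ (V k) k (realCycle (V k) k (hv.rep j)).2⟩
  have hz : ∀ j, (Submodule.Quotient.mk (z j) : Homology ℝ (whole C) k) =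
      inclHomology ℝ (V k) k (v j) := fun j => by
    rw [← hv.mk_rep j]
    rfl
  choose a₁ ha₁ using fun j => exists_cycle_eq S (h k) (z j)
  choose a₂ ha₂ using fun e => exists_cycle_eq S (h k) ⟨_, sub_lift_mem_cycles S T k e⟩
  refine ⟨Matrix.of fun i => Sum.elim (fun j => a₁ j i) fun e => a₂ e i,
    Matrix.of fun i e => (h k).repr (Submodule.Quotient.mk ⟨_, sub_lift_mem_cycles S T k e⟩) i, ?_⟩
  ext e c
  rw [Matrix.mul_apply, Fintype.sum_sum_type, Fintype.sum_sum_type]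
  rcases c with e' | j | e'
  · simp only [Matrix.fromBlocks_apply₁₁, Matrix.fromBlocks_apply₂₁, Matrix.zero_apply, mul_zero,
      Finset.sum_const_zero, add_zero]
    have := congrFun (congrArg Subtype.val ((S.b k).sum_repr (cellBoundary e'.1))) e
    rw [cellBoundary_apply, Submodule.coe_sum, Finset.sum_apply] at this
    refine Eq.trans (Finset.sum_congr rfl fun i _ => ?_) this
    exact mul_comm _ _
  · simp only [Matrix.fromBlocks_apply₁₂, Matrix.fromBlocks_apply₂₂, Matrix.fromBlocks_apply₂₁,
      Matrix.fromBlocks_apply₁₁, Matrix.zero_apply, mul_zero, Finset.sum_const_zero, add_zero]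
    have := congrFun (ha₁ j) e
    rw [Pi.add_apply, Finset.sum_apply, Finset.sum_apply] at this
    refine Eq.trans (congrArg₂ _ (Finset.sum_congr rfl fun i _ => mul_comm _ _)
      (Finset.sum_congr rfl fun i _ => ?_)) this.symm
    rw [LinearMap.toMatrix_apply, ← hz]
    exact mul_comm _ _
  · simp only [Matrix.fromBlocks_apply₁₂, Matrix.fromBlocks_apply₂₂]
    have := congrFun (ha₂ e') e
    change (Pi.single e'.1 1 - ∑ i, treeCoords S T k i e' • S.lift k i : Chains C ℝ k) e = _ at this
    rw [Pi.sub_apply, sub_eq_iff_eq_add, Pi.add_apply, Finset.sum_apply, Finset.sum_apply,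
      Finset.sum_apply, add_assoc] at this
    refine Eq.trans (congrArg₂ _ (Finset.sum_congr rfl fun i _ => mul_comm _ _)
      (congrArg₂ _ (Finset.sum_congr rfl fun i _ => mul_comm _ _)
        (Finset.sum_congr rfl fun i _ => mul_comm _ _))) this.symm

theorem detSq_adaptedMatrix [DecidableEq κ] (hTV : (T k).I k ⊆ (V k).I k)
    (hv : IsCombinatorialBasis v) (e₁ : (T (k + 1)).I (k + 1) ≃ {e // e ∉ (V k).I k})
    (e₂ : κ ≃ {e // e ∈ (V k).I k ∧ e ∉ (T k).I k}) :
    detSq (adaptedMatrix T hv) =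
      detSq ((outsideMatrix (T (k + 1)) (V k) k).map (Int.cast : ℤ → ℝ)) *
        detSq ((hv.cycleMatrix (T k)).map (Int.cast : ℤ → ℝ)) := by
  -- In this order of the cells, the cycles of V vanish on the first group and the cells of T on the
  -- first two, so the matrix is lower triangular.
  let ρ : {e // e ∉ (V k).I k} ⊕ {e // e ∈ (V k).I k ∧ e ∉ (T k).I k} ⊕ (T k).I k ≃ cell C k :=
    .ofBijective (Sum.elim Subtype.val (Sum.elim Subtype.val Subtype.val)) <| by
      constructor
      · rintro (a | a | a) (b | b | b) hab <;> simp only [Sum.elim_inl, Sum.elim_inr] at hab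
        · rw [Subtype.ext hab]
        · exact absurd (hab ▸ b.2.1) a.2
        · exact absurd (hab ▸ hTV b.2) a.2
        · exact absurd (hab ▸ a.2.1) b.2
        · rw [Subtype.ext hab]
        · exact absurd (hab ▸ b.2) a.2.2
        · exact absurd (hab ▸ hTV a.2) b.2
        · exact absurd (hab ▸ a.2) b.2.2
        · rw [Subtype.ext hab]
      · intro e
        by_cases h1 : e ∈ (V k).I k
        · by_cases h2 : e ∈ (T k).I k
          · exact ⟨.inr (.inr ⟨e, h2⟩), rfl⟩
          · exact ⟨.inr (.inl ⟨e, h1, h2⟩), rfl⟩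
        · exact ⟨.inl ⟨e, h1⟩, rfl⟩
  have h : (adaptedMatrix T hv).submatrix ρ id =
      Matrix.fromBlocks ((outsideMatrix (T (k + 1)) (V k) k).map (Int.cast : ℤ → ℝ)) 0
        (Matrix.of fun e => (fun e' => (boundaryMatrix C k (ρ (.inr e)) e'.1 : ℝ)))
        (Matrix.fromBlocks ((hv.cycleMatrix (T k)).map (Int.cast : ℤ → ℝ)) 0
          (Matrix.of fun e j => ((hv.rep j).1 e.1 : ℝ)) 1) := by
    ext e c
    rcases e with e | e | e <;> rcases c with c | c | c
    · rfl
    · change ((hv.rep c).1 e.1 : ℝ) = 0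
      rw [cycles_le_chains ℤ (V k) k (hv.rep c).2 e.1 e.2, Int.cast_zero]
    · change (Pi.single c.1 1 : cell C k → ℝ) e.1 = 0
      refine Pi.single_eq_of_ne (fun h => e.2 (by rw [h]; exact hTV c.2)) _
    · rfl
    · rfl
    · change (Pi.single c.1 1 : cell C k → ℝ) e.1 = 0
      refine Pi.single_eq_of_ne (fun h => e.2.2 (by rw [h]; exact c.2)) _
    · rfl
    · rfl
    · change (Pi.single c.1 1 : cell C k → ℝ) e.1 = (1 : Matrix _ _ ℝ) e c
      by_cases h : e = c
      · subst h
        simp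
      · rw [Matrix.one_apply_ne h]
        exact Pi.single_eq_of_ne (fun h' => h (Subtype.ext h')) _
  rw [← detSq_submatrix ρ, h, detSq_fromBlocks_zero₁₂ e₁ (Equiv.sumCongr e₂ (.refl _)),
    detSq_fromBlocks_zero₁₂ e₂ (.refl _), detSq_one, mul_one]

end Blocks

/-! ### Comparison in a single degree -/

section Degree

open Classical

universe u

variable {X : Type u} [TopologicalSpace X] [T2Space X] {C : Set X} [CWComplex C]
  [CWComplex.Finite C] {T V : ℕ → Subcomplex C} (S : TorsionChoices C)

theorem detSq_treeCoords_ne_zero (hT₀ : (T 0 : Set X) = ∅)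
    (hT : ∀ k, IsSpanningTree k (T (k + 1))) : ∀ k, detSq (treeCoords S T k) ≠ 0
  | 0 => by
    have : IsEmpty ((T 0).I 0) := by
      rw [I_eq_empty hT₀ 0]
      infer_instance
    rw [detSq_of_isEmpty]
    exact one_ne_zero
  | k + 1 => by
    have h : treeCoords S T (k + 1) = LinearMap.toMatrix (hT k).basis (S.b k) LinearMap.id := by
      refine Matrix.ext fun i e => Eq.trans ?_ (LinearMap.toMatrix_apply _ _ _ _ _).symm
      rw [LinearMap.id_apply, (hT k).basis_apply]
      rfl
    rw [h]
    exact detSq_toMatrix_ne_zero _ _ _ Function.bijective_id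

variable {ι : ℕ → Type*} [∀ k, Fintype (ι k)] [∀ k, DecidableEq (ι k)] {κ : ℕ → Type*}
  [∀ k, Fintype (κ k)] [∀ k, DecidableEq (κ k)]

theorem theta_eq (hT : ∀ k, IsSpanningTree k (T (k + 1)))
    (hV : ∀ k, IsHomologyTruncation k (T k) (V k)) :
    ∀ (k : ℕ) {κ : Type*} [Fintype κ] {v : Module.Basis κ ℝ (Homology ℝ (V k) k)}
      (hv : IsCombinatorialBasis v)
      (_ : Nat.card (({e // e ∈ (V k).I k ∧ e ∉ (T k).I k} → ℤ) ⧸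
        LinearMap.range (hv.cycleMatrix (T k)).mulVecLin) ≠ 0),
      theta (T k) k = theta (V k) k *
        Nat.card (({e // e ∈ (V k).I k ∧ e ∉ (T k).I k} → ℤ) ⧸
          LinearMap.range (hv.cycleMatrix (T k)).mulVecLin)
  | 0, _, _, _, hv, _ => by
    rw [card_middle_quotient_zero (hV 0) hv]
    rfl
  | k + 1, _, _, _, hv, hne => theta_succ (hT k) (hV (k + 1)) hv hne

theorem detSq_changeOfBasis (hT₀ : (T 0 : Set X) = ∅)
    (h : ∀ k, Module.Basis (ι k) ℝ (Homology ℝ (whole C) k))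
    (hT : ∀ k, IsSpanningTree k (T (k + 1)))
    (hV : ∀ k, IsHomologyTruncation k (T k) (V k))
    (v : ∀ k, Module.Basis (κ k) ℝ (Homology ℝ (V k) k))
    (hv : ∀ k, IsCombinatorialBasis (v k)) (k : ℕ) :
    detSq (S.changeOfBasis h k) =
      ((theta (T k) k : ℝ) ^ 2 * (tq (T (k + 1)) (V k) k : ℝ) ^ 2) /
        ((theta (V k) k : ℝ) ^ 2 * chi (v k) (h k)) *
        (detSq (treeCoords S T (k + 1)) * detSq (treeCoords S T k))⁻¹ := by
  have c₁ : (T (k + 1)).I (k + 1) ≃ Fin (rankPrev C (k + 1)) :=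
    Fintype.equivFinOfCardEq (card_tree hT₀ hT (k + 1))
  have c₃ : (T k).I k ≃ Fin (rankPrev C k) := Fintype.equivFinOfCardEq (card_tree hT₀ hT k)
  have hf := (hV k).bijective k le_rfl
  have c₂ : κ k ≃ ι k := ((v k).map (LinearEquiv.ofBijective _ hf)).indexEquiv (h k)
  have e₁ : (T (k + 1)).I (k + 1) ≃ {e // e ∉ (V k).I k} :=
    Fintype.equivOfCardEq (card_outside hT₀ hT hV k)
  have e₂ : κ k ≃ {e // e ∈ (V k).I k ∧ e ∉ (T k).I k} := Fintype.equivOfCardEq <|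
    (Module.finrank_eq_card_basis (v k)).symm.trans (card_middle hT₀ hT hV k)
  obtain ⟨B, D, hBD⟩ := exists_mul_eq_adaptedMatrix S (T := T) h (hv k)
  have h1 := congrArg detSq hBD
  rw [detSq_mul (Equiv.sumCongr c₁ (Equiv.sumCongr c₂ c₃)),
    detSq_fromBlocks_zero₂₁ c₁ (Equiv.sumCongr c₂ c₃), detSq_fromBlocks_zero₂₁ c₂ c₃,
    detSq_adaptedMatrix ((hV k).I_subset k) (hv k) e₁ e₂] at h1
  obtain ⟨h2, -⟩ := card_quotient_range_mulVecLin e₁ _ (outsideMatrix_injective (hT k) (hV k))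
  obtain ⟨h3, hne⟩ := card_quotient_range_mulVecLin e₂ _
    ((hv k).cycleMatrix_injective hT₀ hT)
  rw [← tq_eq] at h2
  have h4 := theta_eq hT hV k (hv k) hne
  have h5 : (theta (V k) k : ℝ) ≠ 0 := Nat.cast_ne_zero.2 (theta_ne_zero _ _)
  have h6 : chi (v k) (h k) ≠ 0 := detSq_toMatrix_ne_zero _ _ _ hf
  have h7 := detSq_treeCoords_ne_zero S hT₀ hT k
  have h8 := detSq_treeCoords_ne_zero S hT₀ hT (k + 1)
  rw [← h2, ← h3] at h1
  -- The identity now reads D_k² · det²U_{k+1} · χ_k · det²U_k = t(q_k)² · index², with index =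
  -- θ_T/θ_V.
  change _ * (_ * (chi (v k) (h k) * _)) = _ at h1
  rw [h4, Nat.cast_mul]
  field_simp
  linear_combination h1

end Degree

/-! ### Alternating products -/

theorem prod_alternating_telescope (u : ℕ → ℝ) (hu : ∀ k, u k ≠ 0) : ∀ n,
    ∏ k ∈ Finset.range n, (u (k + 1) * u k) ^ ((-1 : ℤ) ^ k) = u 0 * (u n ^ ((-1 : ℤ) ^ n))⁻¹
  | 0 => by simp [hu 0]
  | n + 1 => by
    rw [Finset.prod_range_succ, prod_alternating_telescope u hu n, mul_zpow, pow_succ, mul_neg_one,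
      zpow_neg, inv_inv]
    have := zpow_ne_zero ((-1 : ℤ) ^ n) (hu n)
    field_simp

/-- A common bound n beyond which all factors are 1 turns both products into finite ones. The
telescoped remainder consists of u 0 and u n, both equal to 1. -/
theorem finprod_alternating_eq (A B u : ℕ → ℝ) (hu : ∀ k, u k ≠ 0) (hu₀ : u 0 = 1)
    (h : ∀ k, A k = B k * (u (k + 1) * u k)⁻¹) (n : ℕ) (hA : ∀ k, n ≤ k → A k = 1)
    (hun : ∀ k, n ≤ k → u k = 1) :
    ∏ᶠ k, A k ^ ((-1 : ℤ) ^ k) = ∏ᶠ k, B k ^ ((-1 : ℤ) ^ k) := by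
  have hB : ∀ k, n ≤ k → B k = 1 := fun k hk => by
    have := h k
    rw [hA k hk, hun k hk, hun (k + 1) (Nat.le_succ_of_le hk)] at this
    simpa using this.symm
  have hfin : ∀ F : ℕ → ℝ, (∀ k, n ≤ k → F k = 1) →
      ∏ᶠ k, F k ^ ((-1 : ℤ) ^ k) = ∏ k ∈ Finset.range n, F k ^ ((-1 : ℤ) ^ k) := fun F hF =>
    finprod_eq_prod_of_mulSupport_subset _ fun k hk => by
      by_contra hk'
      refine hk ?_
      rw [Finset.coe_range, Set.mem_Iio, not_lt] at hk'
      change F k ^ _ = 1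
      rw [hF k hk', one_zpow]
  rw [hfin A hA, hfin B hB]
  simp only [h, mul_zpow, inv_zpow, Finset.prod_mul_distrib, Finset.prod_inv_distrib]
  have := prod_alternating_telescope u hu n
  simp only [mul_zpow, Finset.prod_mul_distrib] at this
  rw [this, hu₀, hun n le_rfl]
  simp

/-! ### Degrees without cells -/

section Empty

universe u

variable {X : Type u} [TopologicalSpace X] [T2Space X] {C : Set X} [CWComplex C]
  [CWComplex.Finite C]

theorem finrank_boundaries_of_isEmpty (E : Subcomplex C) (k : ℕ) [IsEmpty (cell C k)] :
    Module.finrank ℝ (boundaries ℝ E k) = 0 := Module.finrank_zero_of_subsingleton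

theorem rankPrev_of_isEmpty {k : ℕ} [IsEmpty (cell C k)] : rankPrev C k = 0 := by
  cases k with
  | zero => rfl
  | succ k =>
    have h : boundaries ℝ (whole C) k = ⊥ := by
      rw [boundaries, Subsingleton.elim (chains ℝ (whole C) (k + 1)) ⊥, Submodule.map_bot]
    rw [rankPrev, h, finrank_bot]

theorem detSq_changeOfBasis_of_isEmpty (S : TorsionChoices C) {ι : ℕ → Type*}
    [∀ k, Fintype (ι k)] [∀ k, DecidableEq (ι k)]
    (h : ∀ k, Module.Basis (ι k) ℝ (Homology ℝ (whole C) k)) (k : ℕ) [IsEmpty (cell C k)] :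
    detSq (S.changeOfBasis h k) = 1 := by
  have h1 : IsEmpty (Fin (rankPrev C (k + 1))) := by
    rw [rankPrev, finrank_boundaries_of_isEmpty]
    infer_instance
  have h2 : IsEmpty (Fin (rankPrev C k)) := by
    rw [rankPrev_of_isEmpty]
    infer_instance
  have h3 : IsEmpty (ι k) := by
    have h4 : Subsingleton (Homology ℝ (whole C) k) :=
      (Submodule.mkQ_surjective _).subsingleton
    have h5 := Module.finrank_eq_card_basis (h k)
    rw [Module.finrank_zero_of_subsingleton] at h5
    exact Fintype.card_eq_zero_iff.1 h5.symm
  exact detSq_of_isEmpty _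

end Empty
end CellTorsion

/-! ### The torsion formula -/

theorem mainTheorem8 {X : Type*} [TopologicalSpace X] [T2Space X] (C : Set X) [CWComplex C]
    [CWComplex.Finite C] (hC : IsConnected C)
    {ι : ℕ → Type*} [∀ k, Fintype (ι k)] [∀ k, DecidableEq (ι k)]
    (h : ∀ k, Module.Basis (ι k) ℝ (CellTorsion.Homology ℝ (CellTorsion.whole C) k))
    (hh : ∀ k, CellTorsion.IsCombinatorialBasis (h k))
    (T V : ℕ → Subcomplex C)
    (hT₀ : (T 0 : Set X) = ∅)
    (hT : ∀ k, CellTorsion.IsSpanningTree k (T (k + 1)))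
    (hV : ∀ k, CellTorsion.IsHomologyTruncation k (T k) (V k))
    {κ : ℕ → Type*} [∀ k, Fintype (κ k)] [∀ k, DecidableEq (κ k)]
    (v : ∀ k, Module.Basis (κ k) ℝ (CellTorsion.Homology ℝ (V k) k))
    (hv : ∀ k, CellTorsion.IsCombinatorialBasis (v k))
    (S : CellTorsion.TorsionChoices C) :
    CellTorsion.torsionSq S h =
      ∏ᶠ k : ℕ,
        (((CellTorsion.theta (T k) k : ℝ) ^ 2 * (CellTorsion.tq (T (k + 1)) (V k) k : ℝ) ^ 2) /
          ((CellTorsion.theta (V k) k : ℝ) ^ 2 * CellTorsion.chi (v k) (h k))) ^ ((-1 : ℤ) ^ k) := by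
  classical
  obtain ⟨n, hn⟩ := Filter.eventually_atTop.1
    (RelCWComplex.FiniteDimensional.eventually_isEmpty_cell (C := C) (D := ∅))
  have hu : ∀ k, IsEmpty ((T k).I k) →
      CellTorsion.detSq (CellTorsion.treeCoords S T k) = 1 := fun k _ =>
    CellTorsion.detSq_of_isEmpty _
  refine CellTorsion.finprod_alternating_eq _ _
    (fun k => CellTorsion.detSq (CellTorsion.treeCoords S T k))
    (CellTorsion.detSq_treeCoords_ne_zero S hT₀ hT)
    (hu 0 (Set.isEmpty_coe_sort.2 (CellTorsion.I_eq_empty hT₀ 0)))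
    (CellTorsion.detSq_changeOfBasis S hT₀ h hT hV v hv) n (fun k hk => ?_) fun k hk => ?_
  · have := hn k hk
    exact CellTorsion.detSq_changeOfBasis_of_isEmpty S h k
  · have := hn k hk
    exact hu k inferInstance
end
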